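/- **Theorem C.** A *metric valued field* is a field $K$ with a multiplicative valuation $|\cdot|:K\to\mathbb{R}_{\ge 0}$ (so $|x|=0$ iff $x=0$, $|xy|=|x||y|$, $|x+y|\le\max(|x|,|y|)$; the trivial valuation is allowed) that is complete for the metric $|x-y|$. It has characteristic $(a,b)$ if $K$ has characteristic $a$ and its residue field has characteristic $b$. Write points of the projective line $K\mathbb{P}^1$ as $\mathbf a=[a^\circ:a^*]$ with $\max(|a^\circ|,|a^*|)=1$. Let $\mathcal{L}_{\mathbf P}$ be the continuous-logic language with a constant $\infty$ and, for each $n$ and each $P\in\mathbb{Z}[X_1,\dots,X_n]$, an $n$-ary $[0,1]$-valued predicate $\|P(\bar x)\|$ whose modulus of uniform continuity is the identity. $K\mathbb{P}^1$ is an $\mathcal{L}_{\mathbf P}$-structure with $d(\mathbf a,\mathbf b)=|a^\circ b^*-a^*b^\circ|$, $\infty=[1:0]$ and $\|P(\bar{\mathbf a})\|=|P^h(\bar a^\circ,\bar a^*)|$, where $P^h$ is the homogenisation of $P$ separately in each variable. Let $MVF_{(a,b)}$ be the $\mathcal{L}_{\mathbf P}$-theory of the structures $K\mathbb{P}^1$,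 $K$ a metric valued field of characteristic $(a,b)$. Let $\mathcal{L}_{\mathbf P,\sigma}$ be $\mathcal{L}_{\mathbf P}$ with an added unary function symbol $\sigma$ whose modulus is the identity, and let $MVF_{(a,b),\sigma}$ be the $\mathcal{L}_{\mathbf P,\sigma}$-theory consisting of $MVF_{(a,b)}$ and the axioms $$\|P(\bar x)\|=\|P(\sigma(\bar x))\|\ \text{ for all }\bar x\quad(P\in\mathbb{Z}[\bar X]),\qquad d(\infty,\sigma(\infty))=0,\qquad \sup_y\inf_x\|\sigma(x)-y\|=0 .$$ A theory $T'$ in the language of a continuous-logic theory $T$ is a *model-companion* of $T$ if every model of $T$ embeds into a model of $T'$, every model of $T'$ embeds into a model of $T$, and every embedding between models of $T'$ is elementary. Then for every $(a,b)\in\{(0,0),(0,p),(p,p)\mid p\text{ prime}\}$ the theory $MVF_{(a,b),\sigma}$ has no model-companion. Moreover, in mixed characteristic the same holds after normalising the valuation: for every prime $p$ and every real $r$ with $0<r<1$, the theory $MVF_{(0,p),\sigma}\cup\{\|p\|=r\}$ has no model-companion. -/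

import Mathlib

universe u

namespace ContLogic

open unitInterval

/-! Continuous first-order logic for bounded metric structures (diameter at most `1`, predicates
with values in `[0,1]`). -/

/-- A one-sorted continuous language: function symbols (those of arity `0` are the constants) and
predicate symbols, each with an arity and a modulus of uniform continuity. -/
structure Language where
  Func : ℕ → Type
  Rel : ℕ → Type
  funcMod : ∀ {n : ℕ}, Func n → ℝ → ℝ
  relMod : ∀ {n : ℕ}, Rel n → ℝ → ℝ
  funcMod_pos : ∀ {n : ℕ} (f : Func n) (ε : ℝ), 0 < ε → 0 < funcMod f ε
  relMod_pos : ∀ {n : ℕ} (R : Rel n) (ε : ℝ), 0 < ε → 0 < relMod R ε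

/-- An `L`-structure: a nonempty complete metric space of diameter at most `1`, together with
interpretations of the symbols which respect the moduli of uniform continuity (finite powers
carry the maximum metric). -/
structure Structure (L : Language) where
  Carrier : Type u
  [metric : MetricSpace Carrier]
  [complete : CompleteSpace Carrier]
  [nonempty : Nonempty Carrier]
  dist_le_one : ∀ x y : Carrier, dist x y ≤ 1
  func : ∀ {n : ℕ}, L.Func n → (Fin n → Carrier) → Carrier
  rel : ∀ {n : ℕ}, L.Rel n → (Fin n → Carrier) → I
  func_unif : ∀ {n : ℕ} (f : L.Func n) (ε : ℝ), 0 < ε → ε ≤ 1 → ∀ x y : Fin n → Carrier,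
    (∀ i, dist (x i) (y i) < L.funcMod f ε) → dist (func f x) (func f y) ≤ ε
  rel_unif : ∀ {n : ℕ} (R : L.Rel n) (ε : ℝ), 0 < ε → ε ≤ 1 → ∀ x y : Fin n → Carrier,
    (∀ i, dist (x i) (y i) < L.relMod R ε) → |(rel R x : ℝ) - (rel R y : ℝ)| ≤ ε

attribute [instance] Structure.metric Structure.complete Structure.nonempty

/-- Terms in `n` variables. -/
inductive Term (L : Language) (n : ℕ) : Type
  | var (i : Fin n) : Term L n
  | app {k : ℕ} (f : L.Func k) (ts : Fin k → Term L n) : Term L n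

/-- Formulas in `n` free variables. The connectives are all continuous functions
`[0,1]^k → [0,1]`; the quantifiers `sup` and `inf` bind the last variable. -/
inductive Formula (L : Language) : ℕ → Type
  | dist {n : ℕ} (s t : Term L n) : Formula L n
  | rel {n k : ℕ} (R : L.Rel k) (ts : Fin k → Term L n) : Formula L n
  | conn {n k : ℕ} (c : C(Fin k → I, I)) (φ : Fin k → Formula L n) : Formula L n
  | sup {n : ℕ} (φ : Formula L (n + 1)) : Formula L n
  | inf {n : ℕ} (φ : Formula L (n + 1)) : Formula L n

/-- Sentences. -/
abbrev Sentence (L : Language) : Type := Formula L 0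

section Semantics

variable {L : Language}

/-- The value of a term. -/
def Term.eval (M : Structure.{u} L) {n : ℕ} (v : Fin n → M.Carrier) : Term L n → M.Carrier
  | .var i => v i
  | .app f ts => M.func f (fun j => (ts j).eval M v)

/-- The value of a formula. -/
noncomputable def Formula.eval (M : Structure.{u} L) :
    {n : ℕ} → Formula L n → (Fin n → M.Carrier) → I
  | _, .dist s t, v => ⟨Dist.dist (s.eval M v) (t.eval M v), dist_nonneg, M.dist_le_one _ _⟩
  | _, .rel R ts, v => M.rel R (fun j => (ts j).eval M v)
  | _, .conn c φ, v => c (fun j => (φ j).eval M v)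
  | _, .sup φ, v => ⨆ x : M.Carrier, φ.eval M (Fin.snoc (α := fun _ => M.Carrier) v x)
  | _, .inf φ, v => ⨅ x : M.Carrier, φ.eval M (Fin.snoc (α := fun _ => M.Carrier) v x)

/-- The value of a sentence. -/
noncomputable def Sentence.value (M : Structure.{u} L) (φ : Sentence L) : I :=
  Formula.eval M φ Fin.elim0

/-- A theory is a set of sentences `φ`, each of them standing for the closed condition `φ = 0`. -/
abbrev Theory (L : Language) : Type := Set (Sentence L)

/-- `M ⊨ T`. -/
def Models (M : Structure.{u} L) (T : Theory L) : Prop :=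
  ∀ φ ∈ T, Sentence.value M φ = 0

/-- `f` is an embedding of `L`-structures. -/
structure IsEmbedding (M N : Structure.{u} L) (f : M.Carrier → N.Carrier) : Prop where
  isometry : ∀ x y, dist (f x) (f y) = dist x y
  map_func : ∀ {n : ℕ} (g : L.Func n) (x : Fin n → M.Carrier),
    f (M.func g x) = N.func g (fun i => f (x i))
  map_rel : ∀ {n : ℕ} (R : L.Rel n) (x : Fin n → M.Carrier),
    N.rel R (fun i => f (x i)) = M.rel R x

/-- `f` is elementary: it preserves the values of all formulas. -/
def IsElementary (M N : Structure.{u} L) (f : M.Carrier → N.Carrier) : Prop :=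
  ∀ {n : ℕ} (φ : Formula L n) (x : Fin n → M.Carrier),
    φ.eval N (fun i => f (x i)) = φ.eval M x

/-- `T` is model complete: all embeddings between models of `T` are elementary. -/
def ModelComplete (T : Theory L) : Prop :=
  ∀ M N : Structure.{u} L, Models M T → Models N T →
    ∀ f : M.Carrier → N.Carrier, IsEmbedding M N f → IsElementary M N f

/-- Every model of `T` embeds into a model of `T'`. -/
def EmbedsInModels (T T' : Theory L) : Prop :=
  ∀ M : Structure.{u} L, Models M T →
    ∃ N : Structure.{u} L, Models N T' ∧ ∃ f : M.Carrier → N.Carrier, IsEmbedding M N f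

/-- `T'` is a model-companion of `T`: it is model complete, every model of `T` embeds into a
model of `T'`, and every model of `T'` embeds into a model of `T`. -/
structure IsModelCompanion (T' T : Theory L) : Prop where
  modelComplete : ModelComplete.{u} T'
  embeds : EmbedsInModels.{u} T T'
  embeds' : EmbedsInModels.{u} T' T

end Semantics

section Formulas

variable {L L' : Language}

/-- Translation of terms along a map of function symbols. -/
def Term.map (F : ∀ {k : ℕ}, L.Func k → L'.Func k) {n : ℕ} : Term L n → Term L' n
  | .var i => .var i
  | .app f ts => .app (F f) (fun j => (ts j).map F)

/-- Translation of formulas along a map of function and predicate symbols. -/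
def Formula.map (F : ∀ {k : ℕ}, L.Func k → L'.Func k) (G : ∀ {k : ℕ}, L.Rel k → L'.Rel k) :
    {n : ℕ} → Formula L n → Formula L' n
  | _, .dist s t => .dist (s.map F) (t.map F)
  | _, .rel R ts => .rel (G R) (fun j => (ts j).map F)
  | _, .conn c φ => .conn c (fun j => (φ j).map F G)
  | _, .sup φ => .sup (φ.map F G)
  | _, .inf φ => .inf (φ.map F G)

/-- The connective `(s, t) ↦ |s - t|`. -/
noncomputable def absDiff : C(Fin 2 → I, I) where
  toFun t := ⟨|(t 0 : ℝ) - (t 1 : ℝ)|, abs_nonneg _,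
    abs_sub_le_iff.2 ⟨by linarith [(t 0).2.2, (t 1).2.1], by linarith [(t 0).2.1, (t 1).2.2]⟩⟩
  continuous_toFun := by fun_prop

/-- The formula `|φ - ψ|`; the condition `|φ - ψ| = 0` says that `φ = ψ`. -/
noncomputable def Formula.eq {n : ℕ} (φ ψ : Formula L n) : Formula L n :=
  .conn absDiff ![φ, ψ]

/-- The formula with constant value `r`. -/
noncomputable def Formula.const {n : ℕ} (r : I) : Formula L n :=
  .conn (k := 0) (ContinuousMap.const _ r) Fin.elim0

/-- The sentence `sup_{x_1} … sup_{x_n} φ`. -/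
def Formula.supAll : {n : ℕ} → Formula L n → Sentence L
  | 0, φ => φ
  | _ + 1, φ => supAll (.sup φ)

end Formulas

end ContLogic

namespace MetricValued

open ContLogic unitInterval
open scoped LinearAlgebra.Projectivization

/-! The languages of projective lines over metric valued fields. -/

/-- Function symbols without automorphism: the constant `∞`. -/
inductive FuncP : ℕ → Type
  | infty : FuncP 0

/-- Function symbols with automorphism: the constant `∞` and the unary `σ`. -/
inductive FuncPσ : ℕ → Type
  | infty : FuncPσ 0
  | sigma : FuncPσ 1

/-- The language with the constant `∞` and an `n`-ary predicate `‖P(x̄)‖` for every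
`P ∈ ℤ[X_1, …, X_n]`, all moduli being the identity. -/
def LP : Language where
  Func := FuncP
  Rel n := MvPolynomial (Fin n) ℤ
  funcMod _ := id
  relMod _ := id
  funcMod_pos _ _ h := h
  relMod_pos _ _ h := h

/-- The expansion of `LP` by a unary function symbol `σ` whose modulus is the identity. -/
def LPσ : Language where
  Func := FuncPσ
  Rel n := MvPolynomial (Fin n) ℤ
  funcMod _ := id
  relMod _ := id
  funcMod_pos _ _ h := h
  relMod_pos _ _ h := h

/-- The inclusion of the function symbols of `LP` in those of `LPσ`. -/
def FuncP.incl : ∀ {k : ℕ}, FuncP k → FuncPσ k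
  | _, .infty => .infty

/-- An `LP`-sentence seen as an `LPσ`-sentence. -/
def inclSentence (φ : Sentence LP) : Sentence LPσ :=
  Formula.map (L := LP) (L' := LPσ) FuncP.incl id φ

/-- The homogenisation `P^h` of `P ∈ ℤ[X_1, …, X_n]` separately in each variable. The variable
`X_i` is `Sum.inl i`, the variable `X_i^*` is `Sum.inr i`. -/
noncomputable def homogenize {n : ℕ} (P : MvPolynomial (Fin n) ℤ) :
    MvPolynomial (Fin n ⊕ Fin n) ℤ :=
  ∑ s ∈ P.support, MvPolynomial.C (P.coeff s) *
    ∏ i, (MvPolynomial.X (Sum.inl i) ^ s i *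
      MvPolynomial.X (Sum.inr i) ^ (P.degreeOf i - s i))

section ProjectiveLine

variable {K : Type u} [NormedField K]

/-- A nonzero pair `(x, y)` rescaled to the form `(z, 1)` or `(1, z)` so that the maximum of the
norms of the coordinates is `1`. -/
noncomputable def normPair (v : K × K) : K × K :=
  open Classical in if ‖v.1‖ ≤ ‖v.2‖ then (v.1 / v.2, 1) else (1, v.2 / v.1)

/-- A representative `(a°, a*)` of the point `a = [a° : a*]` with `max |a°| |a*| = 1`. -/
noncomputable def nrep (a : ℙ K (K × K)) : K × K := normPair a.rep

theorem normPair_form (v : K × K) (hv : v ≠ 0) :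
    (‖v.1‖ ≤ ‖v.2‖ ∧ v.2 ≠ 0 ∧ ‖(normPair v).1‖ ≤ 1 ∧ (normPair v).2 = 1 ∧
      v.2 • normPair v = v) ∨
    (‖v.2‖ < ‖v.1‖ ∧ v.1 ≠ 0 ∧ ‖(normPair v).2‖ < 1 ∧ (normPair v).1 = 1 ∧
      v.1 • normPair v = v) := by
  obtain ⟨x, y⟩ := v
  by_cases h : ‖x‖ ≤ ‖y‖
  · left
    have hy : y ≠ 0 := by
      rintro rfl
      have : x = 0 := by simpa using h
      exact hv (by simp [this])
    refine ⟨h, hy, ?_, ?_, ?_⟩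
    · simp only [normPair, h, if_true, norm_div]
      exact div_le_one_of_le₀ h (norm_nonneg _)
    · simp [normPair, h]
    · simp only [normPair, h, if_true, Prod.smul_mk, smul_eq_mul]
      rw [mul_div_cancel₀ _ hy, mul_one]
  · right
    have h' := not_le.1 h
    have hx : x ≠ 0 := by
      rintro rfl
      simp at h
    refine ⟨h', hx, ?_, ?_, ?_⟩
    · simp only [normPair, h, if_false, norm_div]
      exact (div_lt_one (norm_pos_iff.2 hx)).2 h'
    · simp [normPair, h]
    · simp only [normPair, h, if_false, Prod.smul_mk, smul_eq_mul]
      rw [mul_div_cancel₀ _ hx, mul_one]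

theorem normPair_smul (c : K) (hc : c ≠ 0) (v : K × K) : normPair (c • v) = normPair v := by
  have h : ‖c * v.1‖ ≤ ‖c * v.2‖ ↔ ‖v.1‖ ≤ ‖v.2‖ := by
    rw [norm_mul, norm_mul]
    exact mul_le_mul_iff_right₀ (norm_pos_iff.2 hc)
  simp only [normPair, Prod.smul_fst, Prod.smul_snd, smul_eq_mul, h, mul_div_mul_left _ _ hc]

/-- The chosen representative does not depend on the choice inside the class. -/
theorem nrep_mk (v : K × K) (hv : v ≠ 0) : nrep (Projectivization.mk K v hv) = normPair v := by
  have h := Projectivization.mk_rep (Projectivization.mk K v hv)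
  rw [Projectivization.mk_eq_mk_iff'] at h
  obtain ⟨c, hc⟩ := h
  have hc0 : c ≠ 0 := by
    rintro rfl
    exact (Projectivization.rep_nonzero _) (by rw [← hc, zero_smul])
  rw [nrep, ← hc, normPair_smul c hc0]

theorem nrep_form (a : ℙ K (K × K)) :
    (‖(nrep a).1‖ ≤ 1 ∧ (nrep a).2 = 1) ∨ (‖(nrep a).2‖ < 1 ∧ (nrep a).1 = 1) := by
  rcases normPair_form a.rep a.rep_nonzero with h | h
  · exact Or.inl ⟨h.2.2.1, h.2.2.2.1⟩
  · exact Or.inr ⟨h.2.2.1, h.2.2.2.1⟩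

theorem nrep_ne_zero (a : ℙ K (K × K)) : nrep a ≠ 0 := by
  intro h
  rcases nrep_form a with h' | h' <;> simp [h] at h'

theorem mk_nrep (a : ℙ K (K × K)) : Projectivization.mk K (nrep a) (nrep_ne_zero a) = a := by
  conv_rhs => rw [← Projectivization.mk_rep a]
  rw [Projectivization.mk_eq_mk_iff']
  rcases normPair_form a.rep a.rep_nonzero with h | h
  · exact ⟨a.rep.2⁻¹, (inv_smul_eq_iff₀ h.2.1).2 h.2.2.2.2.symm⟩
  · exact ⟨a.rep.1⁻¹, (inv_smul_eq_iff₀ h.2.1).2 h.2.2.2.2.symm⟩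

theorem nrep_injective : Function.Injective (nrep (K := K)) := by
  intro a b h
  rw [← mk_nrep a, ← mk_nrep b]
  simp only [h]

theorem nrep_fst_le (a : ℙ K (K × K)) : ‖(nrep a).1‖ ≤ 1 := by
  rcases nrep_form a with h | h
  · exact h.1
  · simp [h.2]

theorem nrep_snd_le (a : ℙ K (K × K)) : ‖(nrep a).2‖ ≤ 1 := by
  rcases nrep_form a with h | h
  · simp [h.2]
  · exact h.1.le

/-- The distance `d(a, b) = |a° b* - a* b°|`. -/
noncomputable def pdist (a b : ℙ K (K × K)) : ℝ :=
  ‖(nrep a).1 * (nrep b).2 - (nrep a).2 * (nrep b).1‖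

/-- The value `‖P(a)‖ = |P^h(a°, a*)|`. -/
noncomputable def pval {n : ℕ} (P : MvPolynomial (Fin n) ℤ) (a : Fin n → ℙ K (K × K)) : ℝ :=
  ‖MvPolynomial.aeval (Sum.elim (fun i => (nrep (a i)).1) (fun i => (nrep (a i)).2))
    (homogenize P)‖

/-- The point `∞ = [1 : 0]`. -/
noncomputable def pinfty : ℙ K (K × K) :=
  Projectivization.mk K ((1, 0) : K × K) (by simp)

theorem pdist_comm (a b : ℙ K (K × K)) : pdist a b = pdist b a := by
  unfold pdist
  rw [← norm_neg]
  congr 1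
  ring

theorem eq_of_pdist (a b : ℙ K (K × K)) (h : pdist a b = 0) : a = b := by
  rw [pdist, norm_eq_zero] at h
  apply nrep_injective
  rcases nrep_form a with ha | ha <;> rcases nrep_form b with hb | hb <;>
    rw [ha.2, hb.2] at h
  · ext
    · linear_combination h
    · rw [ha.2, hb.2]
  · exfalso
    have : (nrep a).1 * (nrep b).2 = 1 := by linear_combination h
    have h2 := congrArg norm this
    rw [norm_mul, norm_one] at h2
    nlinarith [ha.1, hb.1, norm_nonneg (nrep a).1, norm_nonneg (nrep b).2]
  · exfalso
    have : (nrep a).2 * (nrep b).1 = 1 := by linear_combination -h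
    have h2 := congrArg norm this
    rw [norm_mul, norm_one] at h2
    nlinarith [ha.1, hb.1, norm_nonneg (nrep a).2, norm_nonneg (nrep b).1]
  · ext
    · rw [ha.2, hb.2]
    · linear_combination -h

theorem norm_mul_le_of_le {x y : K} {r : ℝ} (hx : ‖x‖ ≤ 1) (hy : ‖y‖ ≤ r) : ‖x * y‖ ≤ r := by
  rw [norm_mul]
  nlinarith [norm_nonneg x, norm_nonneg y]

theorem nrep_elim_le {n : ℕ} (a : Fin n → ℙ K (K × K)) (i : Fin n ⊕ Fin n) :
    ‖Sum.elim (fun i => (nrep (a i)).1) (fun i => (nrep (a i)).2) i‖ ≤ 1 := by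
  cases i with
  | inl i => exact nrep_fst_le _
  | inr i => exact nrep_snd_le _

variable [IsUltrametricDist K]

theorem norm_sub_le_of_le {x y : K} {r : ℝ} (hx : ‖x‖ ≤ r) (hy : ‖y‖ ≤ r) : ‖x - y‖ ≤ r := by
  rw [sub_eq_add_neg]
  refine (IsUltrametricDist.norm_add_le_max _ _).trans (max_le hx ?_)
  rwa [norm_neg]

theorem pdist_le_one (a b : ℙ K (K × K)) : pdist a b ≤ 1 :=
  norm_sub_le_of_le (norm_mul_le_of_le (nrep_fst_le a) (nrep_snd_le b))
    (norm_mul_le_of_le (nrep_snd_le a) (nrep_fst_le b))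

theorem pdist_triangle_max (a b c : ℙ K (K × K)) :
    pdist a c ≤ max (pdist a b) (pdist b c) := by
  have h1 : pdist a b ≤ max (pdist a b) (pdist b c) := le_max_left _ _
  have h2 : pdist b c ≤ max (pdist a b) (pdist b c) := le_max_right _ _
  generalize max (pdist a b) (pdist b c) = r at h1 h2
  unfold pdist at h1 h2 ⊢
  have key1 : (nrep b).2 * ((nrep a).1 * (nrep c).2 - (nrep a).2 * (nrep c).1) =
      (nrep c).2 * ((nrep a).1 * (nrep b).2 - (nrep a).2 * (nrep b).1) -
      (-(nrep a).2) * ((nrep b).1 * (nrep c).2 - (nrep b).2 * (nrep c).1) := by ring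
  have key2 : (nrep b).1 * ((nrep a).1 * (nrep c).2 - (nrep a).2 * (nrep c).1) =
      (nrep c).1 * ((nrep a).1 * (nrep b).2 - (nrep a).2 * (nrep b).1) -
      (-(nrep a).1) * ((nrep b).1 * (nrep c).2 - (nrep b).2 * (nrep c).1) := by ring
  rcases nrep_form b with hb | hb
  · rw [hb.2, one_mul] at key1
    rw [key1, ← hb.2]
    exact norm_sub_le_of_le (norm_mul_le_of_le (nrep_snd_le c) h1)
      (norm_mul_le_of_le (by rw [norm_neg]; exact nrep_snd_le a) h2)
  · rw [hb.2, one_mul] at key2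
    rw [key2, ← hb.2]
    exact norm_sub_le_of_le (norm_mul_le_of_le (nrep_fst_le c) h1)
      (norm_mul_le_of_le (by rw [norm_neg]; exact nrep_fst_le a) h2)

/-- The metric of the projective line. -/
@[reducible] noncomputable def pmetric : MetricSpace (ℙ K (K × K)) where
  dist := pdist
  dist_self a := by
    rw [pdist, mul_comm, sub_self, norm_zero]
  dist_comm := pdist_comm
  dist_triangle a b c :=
    (pdist_triangle_max a b c).trans (max_le_add_of_nonneg (norm_nonneg _) (norm_nonneg _))
  eq_of_dist_eq_zero h := eq_of_pdist _ _ h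

theorem nrep_close (a b : ℙ K (K × K)) (h : pdist a b < 1) :
    ((nrep a).2 = 1 ∧ (nrep b).2 = 1 ∧ pdist a b = ‖(nrep a).1 - (nrep b).1‖) ∨
    ((nrep a).1 = 1 ∧ (nrep b).1 = 1 ∧ pdist a b = ‖(nrep a).2 - (nrep b).2‖) := by
  rcases nrep_form a with ha | ha <;> rcases nrep_form b with hb | hb
  · left
    refine ⟨ha.2, hb.2, ?_⟩
    rw [pdist, ha.2, hb.2, mul_one, one_mul]
  · exfalso
    rw [pdist, ha.2, hb.2, one_mul] at h
    have h1 : ‖(nrep a).1 * (nrep b).2‖ < 1 := by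
      rw [norm_mul]
      nlinarith [ha.1, hb.1, norm_nonneg (nrep a).1, norm_nonneg (nrep b).2]
    have h2 := IsUltrametricDist.norm_add_le_max ((nrep a).1 * (nrep b).2)
      (-((nrep a).1 * (nrep b).2 - 1))
    rw [norm_neg, neg_sub, add_sub_cancel, norm_one] at h2
    exact absurd h2 (not_le.2 (max_lt h1 h))
  · exfalso
    rw [pdist, ha.2, hb.2, one_mul] at h
    have h1 : ‖(nrep a).2 * (nrep b).1‖ < 1 := by
      rw [norm_mul]
      nlinarith [ha.1, hb.1, norm_nonneg (nrep a).2, norm_nonneg (nrep b).1]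
    have h2 := IsUltrametricDist.norm_add_le_max (1 - (nrep a).2 * (nrep b).1)
      ((nrep a).2 * (nrep b).1)
    rw [sub_add_cancel, norm_one] at h2
    exact absurd h2 (not_le.2 (max_lt h h1))
  · right
    refine ⟨ha.2, hb.2, ?_⟩
    rw [pdist, ha.2, hb.2, mul_one, one_mul, norm_sub_rev]

theorem aeval_norm_le {ι : Type} (q : MvPolynomial ι ℤ) (x : ι → K) (hx : ∀ i, ‖x i‖ ≤ 1) :
    ‖MvPolynomial.aeval x q‖ ≤ 1 := by
  induction q using MvPolynomial.induction_on with
  | C z => simpa using IsUltrametricDist.norm_intCast_le_one K z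
  | add p q hp hq =>
    rw [map_add]
    exact (IsUltrametricDist.norm_add_le_max _ _).trans (max_le hp hq)
  | mul_X p i hp =>
    rw [map_mul, MvPolynomial.aeval_X]
    exact norm_mul_le_of_le hp (hx i)

theorem aeval_lipschitz {ι : Type} (q : MvPolynomial ι ℤ) (x y : ι → K) (hx : ∀ i, ‖x i‖ ≤ 1)
    (hy : ∀ i, ‖y i‖ ≤ 1) (r : ℝ) (hr : 0 ≤ r) (h : ∀ i, ‖x i - y i‖ ≤ r) :
    ‖MvPolynomial.aeval x q - MvPolynomial.aeval y q‖ ≤ r := by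
  induction q using MvPolynomial.induction_on with
  | C z => simpa using hr
  | add p q hp hq =>
    rw [map_add, map_add, add_sub_add_comm]
    exact (IsUltrametricDist.norm_add_le_max _ _).trans (max_le hp hq)
  | mul_X p i hp =>
    simp only [map_mul, MvPolynomial.aeval_X]
    have e : MvPolynomial.aeval x p * x i - MvPolynomial.aeval y p * y i =
        MvPolynomial.aeval x p * (x i - y i) -
          (-(y i)) * (MvPolynomial.aeval x p - MvPolynomial.aeval y p) := by ring
    rw [e]
    exact norm_sub_le_of_le (norm_mul_le_of_le (aeval_norm_le p x hx) (h i))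
      (norm_mul_le_of_le (by rw [norm_neg]; exact hy i) hp)

theorem pval_le_one {n : ℕ} (P : MvPolynomial (Fin n) ℤ) (a : Fin n → ℙ K (K × K)) :
    pval P a ≤ 1 :=
  aeval_norm_le _ _ (nrep_elim_le a)

theorem pval_unif {n : ℕ} (P : MvPolynomial (Fin n) ℤ) (ε : ℝ) (h0 : 0 < ε) (h1 : ε ≤ 1)
    (a b : Fin n → ℙ K (K × K)) (h : ∀ i, pdist (a i) (b i) < ε) :
    |pval P a - pval P b| ≤ ε := by
  refine (abs_norm_sub_norm_le _ _).trans (aeval_lipschitz _ _ _ (nrep_elim_le a)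
    (nrep_elim_le b) ε h0.le ?_)
  have key (i : Fin n) : ‖(nrep (a i)).1 - (nrep (b i)).1‖ ≤ ε ∧
      ‖(nrep (a i)).2 - (nrep (b i)).2‖ ≤ ε := by
    have hi := h i
    rcases nrep_close (a i) (b i) (hi.trans_le h1) with e | e
    · exact ⟨e.2.2 ▸ hi.le, by rw [e.1, e.2.1, sub_self, norm_zero]; exact h0.le⟩
    · exact ⟨by rw [e.1, e.2.1, sub_self, norm_zero]; exact h0.le, e.2.2 ▸ hi.le⟩
  intro i
  cases i with
  | inl i => exact (key i).1
  | inr i => exact (key i).2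

theorem pcomplete [CompleteSpace K] :
    @CompleteSpace (ℙ K (K × K)) pmetric.toUniformSpace := by
  let _ : MetricSpace (ℙ K (K × K)) := pmetric
  have hd : ∀ a b : ℙ K (K × K), dist a b = pdist a b := fun _ _ => rfl
  refine Metric.complete_of_cauchySeq_tendsto fun s hs => ?_
  rw [Metric.cauchySeq_iff] at hs
  obtain ⟨N, hN⟩ := hs 1 one_pos
  have hclose : ∀ m ≥ N, ∀ n ≥ N, pdist (s m) (s n) < 1 := fun m hm n hn => hN m hm n hn
  rcases nrep_form (s N) with hb | hb
  · have h2 : ∀ n ≥ N, (nrep (s n)).2 = 1 := by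
      intro n hn
      rcases nrep_form (s n) with h | h
      · exact h.2
      · rcases nrep_close _ _ (hclose n hn N le_rfl) with e | e
        · exact e.1
        · exfalso
          have e1 := hclose n hn N le_rfl
          rw [e.2.2, hb.2] at e1
          have := IsUltrametricDist.norm_add_le_max (-((nrep (s n)).2 - 1)) (nrep (s n)).2
          rw [norm_neg, neg_sub, sub_add_cancel, norm_one] at this
          exact absurd this (not_le.2 (max_lt e1 h.1))
    have hdist : ∀ m ≥ N, ∀ n ≥ N,
        pdist (s m) (s n) = ‖(nrep (s m)).1 - (nrep (s n)).1‖ := by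
      intro m hm n hn
      rw [pdist, h2 m hm, h2 n hn, mul_one, one_mul]
    have hc : CauchySeq (fun n => (nrep (s n)).1) := by
      rw [Metric.cauchySeq_iff]
      intro ε hε
      obtain ⟨N', hN'⟩ := hs ε hε
      refine ⟨max N N', fun m hm n hn => ?_⟩
      rw [dist_eq_norm, ← hdist m (le_of_max_le_left hm) n (le_of_max_le_left hn)]
      exact hN' m (le_of_max_le_right hm) n (le_of_max_le_right hn)
    obtain ⟨x, hx⟩ := cauchySeq_tendsto_of_complete hc
    have hx1 : ‖x‖ ≤ 1 :=
      le_of_tendsto hx.norm (Filter.Eventually.of_forall fun n => nrep_fst_le _)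
    refine ⟨Projectivization.mk K ((x, 1) : K × K) (by simp), ?_⟩
    rw [Metric.tendsto_atTop] at hx ⊢
    intro ε hε
    obtain ⟨N', hN'⟩ := hx ε hε
    refine ⟨max N N', fun n hn => ?_⟩
    have := hN' n (le_of_max_le_right hn)
    rw [hd, pdist, nrep_mk, h2 n (le_of_max_le_left hn)]
    simpa [normPair, hx1, dist_eq_norm] using this
  · have h2 : ∀ n ≥ N, (nrep (s n)).1 = 1 := by
      intro n hn
      rcases nrep_close _ _ (hclose n hn N le_rfl) with e | e
      · exfalso
        have := hb.1
        rw [e.2.1, norm_one] at this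
        exact lt_irrefl _ this
      · exact e.1
    have hdist : ∀ m ≥ N, ∀ n ≥ N,
        pdist (s m) (s n) = ‖(nrep (s m)).2 - (nrep (s n)).2‖ := by
      intro m hm n hn
      rw [pdist, h2 m hm, h2 n hn, mul_one, one_mul, norm_sub_rev]
    have hlt : ∀ n ≥ N, ‖(nrep (s n)).2‖ ≤ max ‖(nrep (s N)).2‖ (pdist (s N) (s n)) := by
      intro n hn
      rw [hdist N le_rfl n hn, norm_sub_rev]
      have := IsUltrametricDist.norm_add_le_max (nrep (s N)).2
        ((nrep (s n)).2 - (nrep (s N)).2)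
      rwa [add_sub_cancel] at this
    have hc : CauchySeq (fun n => (nrep (s n)).2) := by
      rw [Metric.cauchySeq_iff]
      intro ε hε
      obtain ⟨N', hN'⟩ := hs ε hε
      refine ⟨max N N', fun m hm n hn => ?_⟩
      rw [dist_eq_norm, ← hdist m (le_of_max_le_left hm) n (le_of_max_le_left hn)]
      exact hN' m (le_of_max_le_right hm) n (le_of_max_le_right hn)
    obtain ⟨x, hx⟩ := cauchySeq_tendsto_of_complete hc
    have hx1 : ‖x‖ < 1 := by
      obtain ⟨M, hM⟩ := Metric.tendsto_atTop.1 hx 1 one_pos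
      obtain ⟨n, hn, hn1⟩ : ∃ n, M ≤ n ∧ N ≤ n := ⟨max M N, le_max_left _ _, le_max_right _ _⟩
      have hn2 := hM n hn
      have h3 : ‖(nrep (s n)).2‖ < 1 := by
        refine (hlt n hn1).trans_lt (max_lt hb.1 (hclose N le_rfl n hn1))
      rw [dist_comm, dist_eq_norm] at hn2
      have := IsUltrametricDist.norm_add_le_max (x - (nrep (s n)).2) (nrep (s n)).2
      rw [sub_add_cancel] at this
      exact this.trans_lt (max_lt hn2 h3)
    refine ⟨Projectivization.mk K ((1, x) : K × K) (by simp), ?_⟩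
    rw [Metric.tendsto_atTop] at hx ⊢
    intro ε hε
    obtain ⟨N', hN'⟩ := hx ε hε
    refine ⟨max N N', fun n hn => ?_⟩
    have := hN' n (le_of_max_le_right hn)
    rw [hd, pdist, nrep_mk, h2 n (le_of_max_le_left hn)]
    rw [dist_comm] at this
    simpa [normPair, not_le.2 hx1, dist_eq_norm] using this

variable (K)

/-- The `LP`-structure on the projective line over a metric valued field `K`, that is, over a
field which is complete with respect to a multiplicative ultrametric norm. -/
noncomputable def projLine [CompleteSpace K] : Structure.{u} LP :=
  letI : MetricSpace (ℙ K (K × K)) := pmetric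
  { Carrier := ℙ K (K × K)
    metric := pmetric
    complete := pcomplete
    nonempty := ⟨pinfty⟩
    dist_le_one := pdist_le_one
    func := fun {_} f _ => match f with
      | FuncP.infty => pinfty
    rel := fun {_} P a => ⟨pval P a, norm_nonneg _, pval_le_one P a⟩
    func_unif := by
      intro n f ε h0 h1 x y h
      cases f
      exact (dist_self _).trans_le h0.le
    rel_unif := by
      intro n P ε h0 h1 x y h
      exact pval_unif P ε h0 h1 x y h }

/-- The valued field `K` has characteristic `(a, b)`: `K` has characteristic `a` and its residue
field has characteristic `b`. -/
def HasCharPair (a b : ℕ) : Prop :=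
  CharP K a ∧
    CharP (IsLocalRing.ResidueField (NormedField.valuation (K := K)).valuationSubring) b

end ProjectiveLine

/-- The theory of (projective lines over) metric valued fields of characteristic `(a, b)`. -/
def MVF (a b : ℕ) : Theory LP :=
  {φ | ∀ (K : Type u) [NormedField K] [IsUltrametricDist K] [CompleteSpace K],
    HasCharPair K a b → Sentence.value (projLine K) φ = 0}

/-- The term `σ(t)`. -/
def sigmaT {n : ℕ} (t : Term LPσ n) : Term LPσ n :=
  .app (L := LPσ) (k := 1) FuncPσ.sigma ![t]

/-- The term `∞`. -/
def inftyT {n : ℕ} : Term LPσ n :=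
  .app (L := LPσ) (k := 0) FuncPσ.infty Fin.elim0

/-- The formula `‖P(t_1, …, t_k)‖`. -/
def normF {n k : ℕ} (P : MvPolynomial (Fin k) ℤ) (t : Fin k → Term LPσ n) : Formula LPσ n :=
  .rel (L := LPσ) P t

/-- The condition `‖P(x̄)‖ = ‖P(σ(x̄))‖`, for all `x̄`. -/
noncomputable def axiomII {n : ℕ} (P : MvPolynomial (Fin n) ℤ) : Sentence LPσ :=
  ((normF P fun i => .var i).eq (normF P fun i => sigmaT (.var i))).supAll

/-- The condition `d(∞, σ(∞)) = 0`. -/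
def axiomIII : Sentence LPσ :=
  .dist inftyT (sigmaT inftyT)

/-- The condition `sup_y inf_x ‖σ(x) - y‖ = 0` (here `y` is variable `0` and `x` variable `1`). -/
noncomputable def axiomIV : Sentence LPσ :=
  .sup (.inf (normF (MvPolynomial.X 0 - MvPolynomial.X 1 : MvPolynomial (Fin 2) ℤ)
    ![sigmaT (.var 1), .var 0]))

/-- The theory of metric valued fields of characteristic `(a, b)` with an isometric
automorphism. -/
def MVFσ (a b : ℕ) : Theory LPσ :=
  inclSentence '' MVF.{u} a b ∪
    {φ | ∃ (n : ℕ) (P : MvPolynomial (Fin n) ℤ), φ = axiomII P} ∪ {axiomIII, axiomIV}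

/-- The condition `‖p‖ = r` on the norm of the integer `p`. -/
noncomputable def normEq (p : ℕ) (r : I) : Sentence LPσ :=
  (normF (MvPolynomial.C (p : ℤ) : MvPolynomial (Fin 0) ℤ) Fin.elim0).eq (.const r)

end MetricValued

/-!
Consider, for an element `α` with `‖α‖ ≤ 1` and `d(α, ∞) = 1`, the formula `scaleFormula`, which
measures how well the equation `σ x = α x` can be solved with `‖x‖ = 1 = d(x, ∞)`.

If `‖α‖ < 1` then `‖σ x‖ = ‖x‖ > ‖α x‖`, so that the formula has value at least `1/4`, however
close to `1` the norm of `α` is (`le_scaleBody`). If `‖α‖ = 1` then the equation has an exact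
solution in an extension: take the completion of the field of rational functions `K(t)` with the
Gauss norm and put `σ t = α t` (`exists_gauss_extension`). A model-companion `T` would therefore
have models `N i` with elements `α i` of norm `1 - 1/(i+2)` at which the formula is at least `1/4`.
By Łoś's theorem (`tendsto_formula_eval`) so is its value at the class of `α` in the ultraproduct of
the `N i`, which is a model of `T`. This class has norm `1`, so in some extension, which again
embeds into a model of `T`, the value is `0`: the composite embedding is not elementary.

For the extension one has to know that an abstract model `M` of the theory of projective lines sits
in a genuine projective line. The predicates of `M` are limits along one ultrafilter of the
predicates of genuine projective lines (`exists_ultrafilter_sample`), for otherwise a universal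
sentence would separate them. The limits of the norms of integer polynomials in the affine
coordinates form a valuation on the polynomial ring over `ℤ` in the points of `M` other than `∞`
(`exists_limit_valuation`). This valuation can be read off from the predicates of `M`, hence it is
invariant under `σ`, and `M` embeds into the projective line over the associated complete field
(`exists_extension_of_bijection`).

In mixed characteristic the class of models is larger than the class of projective lines, since in
a limit `‖p‖` may become `0` or `1`. All structures which occur in the argument extend one whose
integers have prescribed norms, and these norms determine the characteristics
(`hasCharPair_of_norm`); so it suffices to fix some value of `‖p‖` in `(0,1)` at the beginning.
-/

namespace ContLogic

open unitInterval Filter Topology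

/-! ### Ultraproducts of metric structures -/

/-- The limit of a sequence in `[0,1]` along the fixed nonprincipal ultrafilter on `ℕ`. -/
noncomputable def ulim (f : ℕ → I) : I :=
  ((hyperfilter ℕ).map f).lim

theorem tendsto_ulim (f : ℕ → I) : Tendsto f (hyperfilter ℕ) (𝓝 (ulim f)) :=
  Ultrafilter.le_nhds_lim ((hyperfilter ℕ).map f)

section Ultraproduct

variable {L : Language}

/-- The product of the carriers, with the pseudometric given by the limits of the distances. -/
def PreUltraproduct (M : ℕ → Structure.{u} L) : Type u :=
  ∀ i, (M i).Carrier

variable (M : ℕ → Structure.{u} L)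

/-- The distance of the `i`-th coordinates, as an element of `[0,1]`. -/
def coordDist (x y : PreUltraproduct M) (i : ℕ) : I :=
  ⟨dist (x i) (y i), dist_nonneg, (M i).dist_le_one _ _⟩

noncomputable instance : PseudoMetricSpace (PreUltraproduct M) where
  dist x y := (ulim (coordDist M x y) : ℝ)
  dist_self x := by
    have h : coordDist M x x = fun _ => 0 := by
      ext i
      simp [coordDist]
    have := tendsto_nhds_unique (tendsto_ulim (coordDist M x x)) (h ▸ tendsto_const_nhds)
    rw [this]
    rfl
  dist_comm x y := by
    have h : coordDist M x y = coordDist M y x := by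
      ext i
      simp [coordDist, dist_comm]
    rw [h]
  dist_triangle x y z := by
    have h (x y : PreUltraproduct M) :
        Tendsto (fun i => dist (x i) (y i)) (hyperfilter ℕ) (𝓝 (ulim (coordDist M x y) : ℝ)) :=
      (continuous_subtype_val.tendsto _).comp (tendsto_ulim (coordDist M x y))
    exact le_of_tendsto_of_tendsto' (h x z) ((h x y).add (h y z)) fun i => dist_triangle _ _ _

theorem tendsto_coord_dist (x y : PreUltraproduct M) :
    Tendsto (fun i => dist (x i) (y i)) (hyperfilter ℕ) (𝓝 (dist x y)) :=
  (continuous_subtype_val.tendsto _).comp (tendsto_ulim (coordDist M x y))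

/-- A sequence of sequences which is Cauchy at a prescribed speed converges to a diagonal
sequence; this only uses that the ultrafilter is nonprincipal. -/
instance : CompleteSpace (PreUltraproduct M) := by
  refine Metric.complete_of_convergent_controlled_sequences (fun n => (1 / 2 : ℝ) ^ n)
    (fun n => by positivity) fun s hs => ?_
  classical
  let Q : ℕ → ℕ → Prop := fun i k =>
    ∀ m ≤ k, ∀ n ≤ k, m ≤ n → dist (s m i) (s n i) < (1 / 2 : ℝ) ^ m
  let x : PreUltraproduct M := fun i => s (Nat.findGreatest (Q i) i) i
  have hQ : ∀ k, ∀ᶠ i in (hyperfilter ℕ : Filter ℕ), Q i k := by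
    intro k
    have : ∀ m ∈ Set.Iic k, ∀ᶠ i in (hyperfilter ℕ : Filter ℕ),
        ∀ n ∈ Set.Iic k, m ≤ n → dist (s m i) (s n i) < (1 / 2 : ℝ) ^ m := by
      intro m _
      refine (eventually_all_finite (Set.finite_Iic k)).2 fun n _ => ?_
      by_cases hmn : m ≤ n
      · filter_upwards [(tendsto_coord_dist M (s m) (s n)).eventually_lt_const
          (hs m m n le_rfl hmn)] with i hi _ using hi
      · exact Eventually.of_forall fun i h => absurd h hmn
    filter_upwards [(eventually_all_finite (Set.finite_Iic k)).2 this] with i hi m hm n hn hmn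
    exact hi m hm n hn hmn
  have hx : ∀ k, dist (s k) x ≤ (1 / 2 : ℝ) ^ k := by
    intro k
    refine le_of_tendsto (tendsto_coord_dist M (s k) x) ?_
    have hk : ∀ᶠ i in (hyperfilter ℕ : Filter ℕ), k ≤ i :=
      Nat.hyperfilter_le_atTop (eventually_ge_atTop k)
    filter_upwards [hQ k, hk] with i hi hki
    have h1 : k ≤ Nat.findGreatest (Q i) i := Nat.le_findGreatest hki hi
    exact (Nat.findGreatest_spec (P := Q i) hki hi k h1 _ le_rfl h1).le
  refine ⟨x, tendsto_iff_dist_tendsto_zero.2 ?_⟩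
  exact squeeze_zero (fun _ => dist_nonneg) hx
    (tendsto_pow_atTop_nhds_zero_of_lt_one (by norm_num) (by norm_num))

/-- Values in `[0,1]` lie within `ε` of their supremum. -/
theorem exists_iSup_le_add {X : Type*} [Nonempty X] (F : X → I) {ε : ℝ} (hε : 0 < ε) :
    ∃ x, ((⨆ x, F x : I) : ℝ) ≤ F x + ε := by
  by_contra! h
  obtain ⟨x₀⟩ := ‹Nonempty X›
  have h0 : (0 : ℝ) ≤ ((⨆ x, F x : I) : ℝ) - ε := by linarith [h x₀, (F x₀).2.1]
  let b : I := ⟨((⨆ x, F x : I) : ℝ) - ε, h0, by linarith [(⨆ x, F x : I).2.2]⟩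
  have hb : (⨆ x, F x : I) ≤ b := iSup_le fun x => by
    change (F x : ℝ) ≤ _ - ε
    linarith [h x]
  have : ((⨆ x, F x : I) : ℝ) ≤ ((⨆ x, F x : I) : ℝ) - ε := hb
  linarith

/-- Values in `[0,1]` lie within `ε` of their infimum. -/
theorem exists_le_iInf_add {X : Type*} [Nonempty X] (F : X → I) {ε : ℝ} (hε : 0 < ε) :
    ∃ x, (F x : ℝ) ≤ ((⨅ x, F x : I) : ℝ) + ε := by
  by_contra! h
  obtain ⟨x₀⟩ := ‹Nonempty X›
  have h0 : ((⨅ x, F x : I) : ℝ) + ε ≤ 1 := by linarith [h x₀, (F x₀).2.2]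
  let b : I := ⟨((⨅ x, F x : I) : ℝ) + ε, by linarith [(⨅ x, F x : I).2.1], h0⟩
  have hb : b ≤ (⨅ x, F x : I) := le_iInf fun x => by
    change _ + ε ≤ (F x : ℝ)
    linarith [h x]
  have : ((⨅ x, F x : I) : ℝ) + ε ≤ ((⨅ x, F x : I) : ℝ) := hb
  linarith

/-- The class of a sequence in the ultraproduct. -/
noncomputable def umk (x : PreUltraproduct M) : SeparationQuotient (PreUltraproduct M) :=
  SeparationQuotient.mk x

/-- A sequence representing an element of the ultraproduct. -/
noncomputable def urep (q : SeparationQuotient (PreUltraproduct M)) : PreUltraproduct M :=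
  Function.surjInv SeparationQuotient.surjective_mk q

theorem umk_urep (q : SeparationQuotient (PreUltraproduct M)) : umk M (urep M q) = q :=
  Function.surjInv_eq SeparationQuotient.surjective_mk q

theorem dist_umk (x y : PreUltraproduct M) : dist (umk M x) (umk M y) = dist x y :=
  SeparationQuotient.dist_mk x y

theorem dist_urep_umk (x : PreUltraproduct M) : dist (urep M (umk M x)) x = 0 := by
  rw [← dist_umk, umk_urep, dist_self]

/-- Finitely many distances which are small in the limit are eventually small. -/
theorem eventually_forall_dist_lt {n : ℕ} {x y : Fin n → PreUltraproduct M} {δ : ℝ}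
    (h : ∀ j, dist (x j) (y j) < δ) :
    ∀ᶠ i in (hyperfilter ℕ : Filter ℕ), ∀ j, dist (x j i) (y j i) < δ :=
  eventually_all.2 fun j => (tendsto_coord_dist M (x j) (y j)).eventually_lt_const (h j)

/-- A function symbol applied coordinatewise. -/
def coordFunc {n : ℕ} (f : L.Func n) (x : Fin n → PreUltraproduct M) : PreUltraproduct M :=
  fun i => (M i).func f fun j => x j i

/-- A predicate symbol evaluated coordinatewise. -/
def coordRel {n : ℕ} (R : L.Rel n) (x : Fin n → PreUltraproduct M) (i : ℕ) : I :=
  (M i).rel R fun j => x j i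

theorem dist_coordFunc_le {n : ℕ} (f : L.Func n) {ε : ℝ} (h0 : 0 < ε) (h1 : ε ≤ 1)
    {x y : Fin n → PreUltraproduct M} (h : ∀ j, dist (x j) (y j) < L.funcMod f ε) :
    dist (coordFunc M f x) (coordFunc M f y) ≤ ε := by
  refine le_of_tendsto (tendsto_coord_dist M _ _) ?_
  filter_upwards [eventually_forall_dist_lt M h] with i hi
  exact (M i).func_unif f ε h0 h1 _ _ hi

theorem abs_ulim_coordRel_sub_le {n : ℕ} (R : L.Rel n) {ε : ℝ} (h0 : 0 < ε) (h1 : ε ≤ 1)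
    {x y : Fin n → PreUltraproduct M} (h : ∀ j, dist (x j) (y j) < L.relMod R ε) :
    |(ulim (coordRel M R x) : ℝ) - (ulim (coordRel M R y) : ℝ)| ≤ ε := by
  have hc (x : Fin n → PreUltraproduct M) : Tendsto (fun i => (coordRel M R x i : ℝ))
      (hyperfilter ℕ) (𝓝 (ulim (coordRel M R x) : ℝ)) :=
    (continuous_subtype_val.tendsto _).comp (tendsto_ulim _)
  refine le_of_tendsto ((hc x).sub (hc y)).abs ?_
  filter_upwards [eventually_forall_dist_lt M h] with i hi
  exact (M i).rel_unif R ε h0 h1 _ _ hi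

theorem eq_zero_of_forall_le {r : ℝ} (h0 : 0 ≤ r) (h : ∀ ε : ℝ, 0 < ε → ε ≤ 1 → r ≤ ε) :
    r = 0 := by
  by_contra hr
  have hpos : 0 < r := lt_of_le_of_ne h0 (Ne.symm hr)
  have := h (min (r / 2) 1) (by positivity) (min_le_right _ _)
  linarith [min_le_left (r / 2) 1]

/-- The ultraproduct of a sequence of structures along the hyperfilter on `ℕ`. -/
noncomputable def ultraproduct : Structure.{u} L where
  Carrier := SeparationQuotient (PreUltraproduct M)
  nonempty := ⟨umk M fun i => (M i).nonempty.some⟩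
  dist_le_one x y := by
    rw [← umk_urep M x, ← umk_urep M y, dist_umk]
    exact (ulim (coordDist M (urep M x) (urep M y))).2.2
  func f x := umk M (coordFunc M f fun j => urep M (x j))
  rel R x := ulim (coordRel M R fun j => urep M (x j))
  func_unif f ε h0 h1 x y h := by
    rw [dist_umk]
    refine dist_coordFunc_le M f h0 h1 fun j => ?_
    rw [← dist_umk, umk_urep, umk_urep]
    exact h j
  rel_unif R ε h0 h1 x y h := by
    refine abs_ulim_coordRel_sub_le M R h0 h1 fun j => ?_
    rw [← dist_umk, umk_urep, umk_urep]
    exact h j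

theorem ultraproduct_func {n : ℕ} (f : L.Func n) (x : Fin n → PreUltraproduct M) :
    (ultraproduct M).func f (fun j => umk M (x j)) = umk M (coordFunc M f x) := by
  refine dist_eq_zero.1 ?_
  refine eq_zero_of_forall_le dist_nonneg fun ε h0 h1 => ?_
  refine (dist_umk M _ _).trans_le (dist_coordFunc_le M f h0 h1 fun j => ?_)
  rw [dist_urep_umk]
  exact L.funcMod_pos f ε h0

theorem ultraproduct_rel {n : ℕ} (R : L.Rel n) (x : Fin n → PreUltraproduct M) :
    (ultraproduct M).rel R (fun j => umk M (x j)) = ulim (coordRel M R x) := by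
  refine Subtype.ext (sub_eq_zero.1 (abs_eq_zero.1 ?_))
  refine eq_zero_of_forall_le (abs_nonneg _) fun ε h0 h1 => ?_
  refine abs_ulim_coordRel_sub_le M R h0 h1 fun j => ?_
  rw [dist_urep_umk]
  exact L.relMod_pos R ε h0

theorem ultraproduct_term {n : ℕ} (t : Term L n) (x : Fin n → PreUltraproduct M) :
    t.eval (ultraproduct M) (fun j => umk M (x j)) =
      umk M fun i => t.eval (M i) fun j => x j i := by
  induction t with
  | var i => rfl
  | app f ts ih =>
    simp only [Term.eval, ih]
    exact ultraproduct_func M f fun j i => (ts j).eval (M i) fun j => x j i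

theorem tendsto_iSup_of_umk (F : ∀ i, (M i).Carrier → I) (G : (ultraproduct M).Carrier → I)
    (h : ∀ w : PreUltraproduct M,
      Tendsto (fun i => F i (w i)) (hyperfilter ℕ) (𝓝 (G (umk M w)))) :
    Tendsto (fun i => ⨆ z, F i z) (hyperfilter ℕ) (𝓝 (⨆ q, G q)) := by
  have key : ulim (fun i => ⨆ z, F i z) = ⨆ q, G q := by
    apply le_antisymm
    · rw [← Subtype.coe_le_coe]
      refine le_of_forall_pos_le_add fun ε hε => ?_
      choose w hw using fun i => exists_iSup_le_add (F i) hε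
      have h1 : (ulim (fun i => ⨆ z, F i z) : ℝ) ≤ G (umk M w) + ε :=
        le_of_tendsto_of_tendsto' ((continuous_subtype_val.tendsto _).comp (tendsto_ulim _))
          (((continuous_subtype_val.tendsto _).comp (h w)).add_const ε) hw
      have h2 : (G (umk M w) : ℝ) ≤ ((⨆ q, G q : I) : ℝ) := le_iSup G (umk M w)
      linarith
    · refine iSup_le fun q => ?_
      rw [← umk_urep M q]
      exact le_of_tendsto_of_tendsto' (h _) (tendsto_ulim _) fun i => le_iSup (F i) _
  exact key ▸ tendsto_ulim _

theorem tendsto_iInf_of_umk (F : ∀ i, (M i).Carrier → I) (G : (ultraproduct M).Carrier → I)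
    (h : ∀ w : PreUltraproduct M,
      Tendsto (fun i => F i (w i)) (hyperfilter ℕ) (𝓝 (G (umk M w)))) :
    Tendsto (fun i => ⨅ z, F i z) (hyperfilter ℕ) (𝓝 (⨅ q, G q)) := by
  have key : ulim (fun i => ⨅ z, F i z) = ⨅ q, G q := by
    apply le_antisymm
    · refine le_iInf fun q => ?_
      rw [← umk_urep M q]
      exact le_of_tendsto_of_tendsto' (tendsto_ulim _) (h _) fun i => iInf_le (F i) _
    · rw [← Subtype.coe_le_coe]
      refine le_of_forall_pos_le_add fun ε hε => ?_
      choose w hw using fun i => exists_le_iInf_add (F i) hε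
      have h1 : (G (umk M w) : ℝ) ≤ (ulim (fun i => ⨅ z, F i z) : ℝ) + ε :=
        le_of_tendsto_of_tendsto' ((continuous_subtype_val.tendsto _).comp (h w))
          (((continuous_subtype_val.tendsto _).comp (tendsto_ulim _)).add_const ε) hw
      have h2 : ((⨅ q, G q : I) : ℝ) ≤ (G (umk M w) : ℝ) := iInf_le G (umk M w)
      linarith
  exact key ▸ tendsto_ulim _

theorem umk_snoc {n : ℕ} (x : Fin n → PreUltraproduct M) (w : PreUltraproduct M) :
    (Fin.snoc (α := fun _ => (ultraproduct M).Carrier) (fun j => umk M (x j)) (umk M w)) =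
      fun j => umk M (Fin.snoc (α := fun _ => PreUltraproduct M) x w j) := by
  ext j
  refine Fin.lastCases ?_ (fun j => ?_) j
  · rw [Fin.snoc_last (α := fun _ => PreUltraproduct M)]
    exact Fin.snoc_last (α := fun _ => (ultraproduct M).Carrier) _ _
  · rw [Fin.snoc_castSucc (α := fun _ => PreUltraproduct M)]
    exact Fin.snoc_castSucc (α := fun _ => (ultraproduct M).Carrier) _ _ _

theorem coord_snoc {n : ℕ} (x : Fin n → PreUltraproduct M) (w : PreUltraproduct M) (i : ℕ) :
    (Fin.snoc (α := fun _ => (M i).Carrier) (fun j => x j i) (w i)) =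
      fun j => Fin.snoc (α := fun _ => PreUltraproduct M) x w j i := by
  ext j
  refine Fin.lastCases ?_ (fun j => ?_) j
  · simp only [Fin.snoc_last]
  · simp only [Fin.snoc_castSucc]

/-- Łoś's theorem: the value of a formula in the ultraproduct is the limit of its values. -/
theorem tendsto_formula_eval {n : ℕ} (φ : Formula L n) (x : Fin n → PreUltraproduct M) :
    Tendsto (fun i => φ.eval (M i) fun j => x j i) (hyperfilter ℕ)
      (𝓝 (φ.eval (ultraproduct M) fun j => umk M (x j))) := by
  induction φ with
  | dist s t =>
    rw [tendsto_subtype_rng]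
    simp only [Formula.eval, ultraproduct_term]
    have e := dist_umk M (fun i => s.eval (M i) fun j => x j i)
      (fun i => t.eval (M i) fun j => x j i)
    have h := tendsto_coord_dist M (fun i => s.eval (M i) fun j => x j i)
      (fun i => t.eval (M i) fun j => x j i)
    rw [← e] at h
    exact h
  | rel R ts =>
    simp only [Formula.eval, ultraproduct_term]
    rw [ultraproduct_rel M R fun j i => (ts j).eval (M i) fun j => x j i]
    exact tendsto_ulim _
  | conn c φ ih =>
    exact (c.continuous.tendsto _).comp (tendsto_pi_nhds.2 fun j => ih j x)
  | sup φ ih =>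
    refine tendsto_iSup_of_umk M
      (fun i z => φ.eval (M i) (Fin.snoc (α := fun _ => (M i).Carrier) (fun j => x j i) z))
      (fun q => φ.eval (ultraproduct M)
        (Fin.snoc (α := fun _ => (ultraproduct M).Carrier) (fun j => umk M (x j)) q)) fun w => ?_
    simp only [umk_snoc, coord_snoc]
    exact ih _
  | inf φ ih =>
    refine tendsto_iInf_of_umk M
      (fun i z => φ.eval (M i) (Fin.snoc (α := fun _ => (M i).Carrier) (fun j => x j i) z))
      (fun q => φ.eval (ultraproduct M)
        (Fin.snoc (α := fun _ => (ultraproduct M).Carrier) (fun j => umk M (x j)) q)) fun w => ?_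
    simp only [umk_snoc, coord_snoc]
    exact ih _

theorem models_ultraproduct {T : Theory L} (h : ∀ i, Models (M i) T) :
    Models (ultraproduct M) T := by
  intro φ hφ
  have h1 := tendsto_formula_eval M φ Fin.elim0
  have h2 (i : ℕ) : φ.eval (M i) (fun j => (Fin.elim0 j : PreUltraproduct M) i) = 0 := by
    rw [← h i φ hφ, Sentence.value]
    congr 1
    exact Subsingleton.elim _ _
  simp only [h2] at h1
  rw [Sentence.value, ← tendsto_nhds_unique h1 tendsto_const_nhds]
  congr 1
  exact Subsingleton.elim _ _

end Ultraproduct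

/-! ### Universal sentences, reducts and embeddings -/

section Formulas

variable {L : Language}

theorem iSup_eq_zero_iff {X : Type*} (F : X → I) : (⨆ x, F x) = 0 ↔ ∀ x, F x = 0 :=
  iSup_eq_bot

theorem value_supAll_eq_zero_iff (M : Structure.{u} L) {n : ℕ} (φ : Formula L n) :
    Sentence.value M φ.supAll = 0 ↔ ∀ x, φ.eval M x = 0 := by
  induction n with
  | zero =>
    refine ⟨fun h x => ?_, fun h => h _⟩
    rw [← h, Sentence.value, Formula.supAll]
    congr 1
    exact Subsingleton.elim _ _
  | succ n ih =>
    rw [Formula.supAll, ih]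
    simp only [Formula.eval, iSup_eq_zero_iff]
    refine ⟨fun h x => ?_, fun h x z => h _⟩
    rw [← h (Fin.init x) (x (Fin.last n)), Fin.snoc_init_self]

theorem IsEmbedding.comp {M N P : Structure.{u} L} {f : M.Carrier → N.Carrier}
    {g : N.Carrier → P.Carrier} (hg : IsEmbedding N P g) (hf : IsEmbedding M N f) :
    IsEmbedding M P (g ∘ f) where
  isometry x y := (hg.isometry _ _).trans (hf.isometry x y)
  map_func h x := (congrArg g (hf.map_func h x)).trans (hg.map_func h _)
  map_rel R x := (hg.map_rel R _).trans (hf.map_rel R x)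

end Formulas

end ContLogic

namespace MetricValued

open ContLogic unitInterval Filter Topology
open scoped LinearAlgebra.Projectivization NNReal

/-- The `LP`-structure obtained from an `LPσ`-structure by forgetting `σ`. -/
def reduct (N : Structure.{u} LPσ) : Structure.{u} LP where
  Carrier := N.Carrier
  dist_le_one := N.dist_le_one
  func f := N.func (FuncP.incl f)
  rel R := N.rel R
  func_unif f := N.func_unif (FuncP.incl f)
  rel_unif R := N.rel_unif (n := _) R

theorem term_map_eval (N : Structure.{u} LPσ) {n : ℕ} (t : Term LP n) (x : Fin n → N.Carrier) :
    (Term.map (L := LP) (L' := LPσ) FuncP.incl t).eval N x = t.eval (reduct N) x := by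
  induction t with
  | var i => rfl
  | app f ts ih =>
    simp only [Term.map, Term.eval, ih]
    rfl

theorem formula_map_eval (N : Structure.{u} LPσ) {n : ℕ} (φ : Formula LP n)
    (x : Fin n → N.Carrier) :
    (Formula.map (L := LP) (L' := LPσ) FuncP.incl id φ).eval N x = φ.eval (reduct N) x := by
  induction φ with
  | dist s t =>
    simp only [Formula.map, Formula.eval, term_map_eval]
    rfl
  | rel R ts =>
    simp only [Formula.map, Formula.eval, term_map_eval]
    rfl
  | conn c φ ih =>
    simp only [Formula.map, Formula.eval, ih]
  | sup φ ih =>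
    simp only [Formula.map, Formula.eval, ih]
    rfl
  | inf φ ih =>
    simp only [Formula.map, Formula.eval, ih]
    rfl

theorem value_inclSentence (N : Structure.{u} LPσ) (φ : Sentence LP) :
    Sentence.value N (inclSentence φ) = Sentence.value (reduct N) φ := by
  rw [Sentence.value, inclSentence, formula_map_eval, Sentence.value]
  congr 1

/-! ### Models of the theory of metric valued fields are limits of projective lines -/

/-- The element named by the constant `∞`. -/
def inftyOf (M : Structure.{u} LP) : M.Carrier :=
  M.func (n := 0) FuncP.infty Fin.elim0

theorem func_infty (M : Structure.{u} LP) (x : Fin 0 → M.Carrier) :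
    M.func (n := 0) FuncP.infty x = inftyOf M :=
  congrArg _ (Subsingleton.elim _ _)

/-- A map from a pointed set to the projective line of some metric valued field of
characteristic `(a, b)` which sends the base point to `∞`. -/
structure Sample (a b : ℕ) (X : Type u) (o : X) : Type (u + 1) where
  K : Type u
  [field : NormedField K]
  [ultra : IsUltrametricDist K]
  [complete : CompleteSpace K]
  char : HasCharPair K a b
  pt : X → ℙ K (K × K)
  pt_base : pt o = pinfty

attribute [instance] Sample.field Sample.ultra Sample.complete

/-- The value `‖P‖` as an element of `[0,1]`. -/
noncomputable def pvalI {K : Type u} [NormedField K] [IsUltrametricDist K] {n : ℕ}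
    (P : MvPolynomial (Fin n) ℤ) (a : Fin n → ℙ K (K × K)) : I :=
  ⟨pval P a, norm_nonneg _, pval_le_one P a⟩

/-- The connective which is positive exactly on the ball of radius `ε` around `r`. -/
noncomputable def bump {k : ℕ} (r : Fin k → I) (ε : ℝ) : C(Fin k → I, I) where
  toFun t := Set.projIcc 0 1 zero_le_one (ε - dist t r)
  continuous_toFun := continuous_projIcc.comp (by fun_prop)

theorem bump_self_ne_zero {k : ℕ} (r : Fin k → I) {ε : ℝ} (hε : 0 < ε) : bump r ε r ≠ 0 := by
  intro h
  have h1 : Set.projIcc (0 : ℝ) 1 zero_le_one (ε - dist r r) = ⟨0, by simp⟩ := h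
  rw [Set.projIcc_eq_left zero_lt_one, dist_self] at h1
  linarith

theorem dist_lt_of_bump_ne_zero {k : ℕ} {r t : Fin k → I} {ε : ℝ} (h : bump r ε t ≠ 0) :
    dist t r < ε := by
  by_contra! h'
  refine h ?_
  have : Set.projIcc (0 : ℝ) 1 zero_le_one (ε - dist t r) = ⟨0, by simp⟩ :=
    Set.projIcc_of_le_left _ (by linarith)
  exact this

/-- Finitely many predicate values of a model of `MVF a b` are approximated in a genuine
projective line: otherwise a universal sentence of `MVF a b` would fail in the model. -/
theorem exists_sample_near {a b : ℕ} (M : Structure.{u} LP) (hM : Models M (MVF.{u} a b))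
    {k : ℕ} (d : Fin k → ℕ) (P : ∀ j, MvPolynomial (Fin (d j)) ℤ)
    (m : ∀ j, Fin (d j) → M.Carrier) {ε : ℝ} (hε : 0 < ε) :
    ∃ S : Sample a b M.Carrier (inftyOf M), ∀ j,
      dist (pvalI (P j) fun i => S.pt (m j i)) (M.rel (n := d j) (P j) (m j)) < ε := by
  classical
  let s : Finset M.Carrier := Finset.univ.biUnion fun j => Finset.univ.image (m j)
  have hs : ∀ j i, m j i ∈ s := fun j i =>
    Finset.mem_biUnion.2 ⟨j, Finset.mem_univ _, Finset.mem_image_of_mem _ (Finset.mem_univ _)⟩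
  let e : s ≃ Fin s.card := s.equivFin
  let τ : M.Carrier → Term LP s.card := fun z =>
    if z = inftyOf M then .app (L := LP) (k := 0) FuncP.infty Fin.elim0
    else if h : z ∈ s then .var (e ⟨z, h⟩)
    else .app (L := LP) (k := 0) FuncP.infty Fin.elim0
  let r : Fin k → I := fun j => M.rel (n := d j) (P j) (m j)
  let φ : Formula LP s.card := .conn (bump r ε) fun j =>
    .rel (L := LP) (k := d j) (P j) fun i => τ (m j i)
  have hMτ : ∀ z ∈ s, (τ z).eval M (fun i => (e.symm i).1) = z := by
    intro z hz
    by_cases h : z = inftyOf M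
    · simp only [τ, h, if_true, Term.eval]
      exact func_infty M _
    · simp only [τ, h, hz, if_false, dif_pos, Term.eval, Equiv.symm_apply_apply]
  have hφM : φ.eval M (fun i => (e.symm i).1) ≠ 0 := by
    have : φ.eval M (fun i => (e.symm i).1) = bump r ε r := by
      simp only [φ, Formula.eval, r]
      congr 1
      ext1 j
      congr 1
      ext1 i
      exact hMτ _ (hs j i)
    rw [this]
    exact bump_self_ne_zero r hε
  have hφ : φ.supAll ∉ MVF.{u} a b := fun h =>
    hφM ((value_supAll_eq_zero_iff M φ).1 (hM _ h) _)
  simp only [MVF, Set.mem_ofPred_eq, not_forall, value_supAll_eq_zero_iff] at hφ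
  obtain ⟨K, _, _, _, hK, x, hx⟩ := hφ
  refine ⟨⟨K, hK, fun z => (τ z).eval (projLine K) x, ?_⟩, fun j => ?_⟩
  · simp only [τ, if_true, Term.eval]
    rfl
  · have h1 := dist_lt_of_bump_ne_zero hx
    exact (dist_pi_lt_iff hε).1 h1 j

/-- The predicates of a model of `MVF a b` are limits, along one ultrafilter, of the predicates
of genuine projective lines. -/
theorem exists_ultrafilter_sample {a b : ℕ} (M : Structure.{u} LP)
    (hM : Models M (MVF.{u} a b)) :
    ∃ U : Ultrafilter (Sample.{u} a b M.Carrier (inftyOf M)),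
      ∀ (n : ℕ) (P : MvPolynomial (Fin n) ℤ) (m : Fin n → M.Carrier),
        Tendsto (fun S : Sample.{u} a b M.Carrier (inftyOf M) => pval P fun i => S.pt (m i)) U
          (𝓝 (M.rel (n := n) P m : ℝ)) := by
  let J := Σ n : ℕ, MvPolynomial (Fin n) ℤ × (Fin n → M.Carrier)
  let E : Sample.{u} a b M.Carrier (inftyOf M) → J → I := fun S j =>
    pvalI j.2.1 fun i => S.pt (j.2.2 i)
  let r : J → I := fun j => M.rel (n := j.1) j.2.1 j.2.2
  have hcl : MapClusterPt r ⊤ E := by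
    rw [mapClusterPt_iff_frequently]
    intro V hV
    rw [frequently_top]
    rw [nhds_pi, Filter.mem_pi] at hV
    obtain ⟨s, hs, t, ht, hst⟩ := hV
    have : ∃ ε : ℝ, 0 < ε ∧ ∀ j ∈ s, ∀ y, dist y (r j) < ε → y ∈ t j := by
      choose δ hδ hδt using fun j => Metric.mem_nhds_iff.1 (ht j)
      rcases s.eq_empty_or_nonempty with rfl | hne
      · exact ⟨1, one_pos, by simp⟩
      · obtain ⟨j₀, -, hj₀⟩ := hs.exists_minimalFor δ s hne
        refine ⟨δ j₀, hδ _, fun j hj y hy => hδt j ?_⟩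
        refine Metric.mem_ball.2 (hy.trans_le ?_)
        by_contra! hlt
        exact absurd (hj₀ hj hlt.le) (not_le.2 hlt)
    obtain ⟨ε, hε, hεt⟩ := this
    let f : Fin hs.toFinset.card ≃ hs.toFinset := hs.toFinset.equivFin.symm
    obtain ⟨S, hS⟩ := exists_sample_near M hM (fun j => (f j).1.1) (fun j => (f j).1.2.1)
      (fun j => (f j).1.2.2) hε
    refine ⟨S, hst fun j hj => hεt j hj _ ?_⟩
    have h := hS (f.symm ⟨j, hs.mem_toFinset.2 hj⟩)
    have e := f.apply_symm_apply ⟨j, hs.mem_toFinset.2 hj⟩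
    change dist (E S (f (f.symm ⟨j, hs.mem_toFinset.2 hj⟩)).1)
      (r (f (f.symm ⟨j, hs.mem_toFinset.2 hj⟩)).1) < ε at h
    rwa [e] at h
  obtain ⟨U, -, hU⟩ := mapClusterPt_iff_ultrafilter.1 hcl
  refine ⟨U, fun n P m => ?_⟩
  exact (continuous_subtype_val.tendsto _).comp ((tendsto_pi_nhds.1 hU) ⟨n, P, m⟩)

/-! ### Complete fields from valuations, and Gauss extensions -/

theorem isUltrametricDist_completion (F : Type u) [NormedField F] [IsUltrametricDist F] :
    IsUltrametricDist (UniformSpace.Completion F) := by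
  refine IsUltrametricDist.isUltrametricDist_of_forall_norm_add_le_max_norm fun x y => ?_
  induction x, y using UniformSpace.Completion.induction_on₂ with
  | hp => exact isClosed_le (by fun_prop) (by fun_prop)
  | ih x y =>
    rw [← UniformSpace.Completion.coe_add]
    simp only [UniformSpace.Completion.norm_coe]
    exact IsUltrametricDist.norm_add_le_max x y

/-- The absolute value on the fraction field of `B ⧸ supp v` induced by a valuation `v` on `B`. -/
noncomputable def fracAbs {B : Type u} [CommRing B] (v : Valuation B ℝ≥0) :
    AbsoluteValue (FractionRing (B ⧸ v.supp)) ℝ :=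
  let w : Valuation (FractionRing (B ⧸ v.supp)) ℝ≥0 :=
    (v.onQuot le_rfl).extendToLocalization (S := nonZeroDivisors (B ⧸ v.supp))
      (by
        intro x hx
        change x ∉ (v.onQuot le_rfl).supp
        rw [Valuation.supp_quot_supp]
        exact nonZeroDivisors.ne_zero hx) _
  { toFun := fun x => (w x : ℝ)
    map_mul' := fun x y => by rw [map_mul, NNReal.coe_mul]
    nonneg' := fun x => NNReal.coe_nonneg _
    eq_zero' := fun x => by rw [NNReal.coe_eq_zero, Valuation.zero_iff]
    add_le' := fun x y => by
      rw [← NNReal.coe_add, NNReal.coe_le_coe]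
      exact (w.map_add x y).trans (max_le_add_of_nonneg zero_le zero_le) }

theorem fracAbs_add_le {B : Type u} [CommRing B] (v : Valuation B ℝ≥0)
    (x y : FractionRing (B ⧸ v.supp)) :
    fracAbs v (x + y) ≤ max (fracAbs v x) (fracAbs v y) := by
  change ((_ : ℝ≥0) : ℝ) ≤ max ((_ : ℝ≥0) : ℝ) ((_ : ℝ≥0) : ℝ)
  rw [← NNReal.coe_max, NNReal.coe_le_coe]
  exact Valuation.map_add _ x y

theorem fracAbs_algebraMap {B : Type u} [CommRing B] (v : Valuation B ℝ≥0) (b : B) :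
    fracAbs v (algebraMap (B ⧸ v.supp) _ (Ideal.Quotient.mk v.supp b)) = v b := by
  change ((_ : ℝ≥0) : ℝ) = _
  rw [Valuation.extendToLocalization_apply_map_apply]
  rfl

/-- A ring with a real valuation `v` has a universal homomorphism to a complete valued field
through which `v` is the norm: the completion of the fraction field of `B ⧸ supp v`. -/
theorem exists_complete_field {B : Type u} [CommRing B] (v : Valuation B ℝ≥0) :
    ∃ (L : Type u) (_ : NormedField L) (_ : IsUltrametricDist L) (_ : CompleteSpace L)
      (ι : B →+* L), (∀ b, ‖ι b‖ = v b) ∧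
      ∀ κ : B →+* L, (∀ b, ‖κ b‖ = v b) →
        ∃ g : L →+* L, (∀ x, ‖g x‖ = ‖x‖) ∧ (∀ b, g (ι b) = κ b) ∧
          ((∀ b, ι b ∈ Set.range g) → Function.Surjective g) := by
  let Q := B ⧸ v.supp
  let F := FractionRing Q
  let _ : NormedField F := (fracAbs v).toNormedField
  have hnorm (x : F) : ‖x‖ = fracAbs v x := rfl
  have : IsUltrametricDist F :=
    IsUltrametricDist.isUltrametricDist_of_forall_norm_add_le_max_norm (fracAbs_add_le v)
  let L := UniformSpace.Completion F
  let ιF : B →+* F := (algebraMap Q F).comp (Ideal.Quotient.mk v.supp)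
  have hιF (b : B) : ‖ιF b‖ = v b := fracAbs_algebraMap v b
  let ι : B →+* L := UniformSpace.Completion.coeRingHom.comp ιF
  have hι (b : B) : ‖ι b‖ = v b := (UniformSpace.Completion.norm_coe (ιF b)).trans (hιF b)
  have hF (x : F) : ∃ a b : B, x = ιF a / ιF b := by
    obtain ⟨a, b, -, rfl⟩ := IsFractionRing.div_surjective (A := Q) x
    obtain ⟨a, rfl⟩ := Ideal.Quotient.mk_surjective a
    obtain ⟨b, rfl⟩ := Ideal.Quotient.mk_surjective b
    exact ⟨a, b, rfl⟩
  refine ⟨L, inferInstance, isUltrametricDist_completion F, inferInstance, ι, hι,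
    fun κ hκ => ?_⟩
  let κQ : Q →+* L := Ideal.Quotient.lift v.supp κ fun b hb => by
    rw [← norm_eq_zero, hκ, (v.mem_supp_iff b).1 hb, NNReal.coe_zero]
  have hκQ : Function.Injective κQ := by
    rw [injective_iff_map_eq_zero]
    intro q hq
    obtain ⟨b, rfl⟩ := Ideal.Quotient.mk_surjective q
    rw [Ideal.Quotient.eq_zero_iff_mem, v.mem_supp_iff, ← NNReal.coe_eq_zero, ← hκ, norm_eq_zero]
    exact hq
  let κF : F →+* L := IsFractionRing.lift hκQ
  have hκF (b : B) : κF (ιF b) = κ b := by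
    simp only [κF, ιF, RingHom.comp_apply, IsFractionRing.lift_algebraMap]
    rfl
  have hn (x : F) : ‖κF x‖ = ‖x‖ := by
    obtain ⟨a, b, rfl⟩ := hF x
    rw [map_div₀, norm_div, norm_div, hκF, hκF, hκ, hκ, hιF, hιF]
  have hiso : Isometry κF := AddMonoidHomClass.isometry_of_norm κF hn
  let g : L →+* L := hiso.extensionHom
  have hg : Isometry g := hiso.completion_extension
  have hgι (b : B) : g (ι b) = κ b := (hiso.extensionHom_coe (ιF b)).trans (hκF b)
  refine ⟨g, fun x => ?_, hgι, fun h y => ?_⟩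
  · rw [← dist_zero_right, ← map_zero g, hg.dist_eq, dist_zero_right]
  · have hcl : IsClosed (Set.range g) := hg.isClosedEmbedding.isClosed_range
    induction y using UniformSpace.Completion.induction_on with
    | hp => exact hcl
    | ih x =>
      obtain ⟨a, b, rfl⟩ := hF x
      obtain ⟨a', ha⟩ := h a
      obtain ⟨b', hb⟩ := h b
      refine ⟨a' / b', ?_⟩
      rw [map_div₀, ha, hb]
      exact (map_div₀ (UniformSpace.Completion.coeRingHom (α := F)) _ _).symm

/-- The Gauss norm with radius `ρ` as a valuation. -/
noncomputable def gaussVal (K : Type u) [NormedField K] [IsUltrametricDist K] (ρ : ℝ)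
    (hρ : 0 < ρ) : Valuation (Polynomial K) ℝ≥0 where
  toFun p := ⟨p.gaussNorm (NormedField.toAbsoluteValue K) ρ, p.gaussNorm_nonneg _ hρ.le⟩
  map_zero' := NNReal.eq (Polynomial.gaussNorm_zero (NormedField.toAbsoluteValue K) ρ)
  map_one' := NNReal.eq ((Polynomial.gaussNorm_C (NormedField.toAbsoluteValue K) ρ 1).trans
    norm_one)
  map_mul' p q := NNReal.eq (Polynomial.gaussNorm_mul (fun x y =>
    IsUltrametricDist.norm_add_le_max x y) hρ p q)
  map_add_le_max' p q := Polynomial.isNonarchimedean_gaussNorm _ (fun x y =>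
    IsUltrametricDist.norm_add_le_max x y) hρ.le p q

theorem gaussVal_C {K : Type u} [NormedField K] [IsUltrametricDist K] {ρ : ℝ} (hρ : 0 < ρ)
    (k : K) : (gaussVal K ρ hρ (Polynomial.C k) : ℝ) = ‖k‖ :=
  Polynomial.gaussNorm_C (NormedField.toAbsoluteValue K) ρ k

theorem gaussVal_X {K : Type u} [NormedField K] [IsUltrametricDist K] {ρ : ℝ} (hρ : 0 < ρ) :
    (gaussVal K ρ hρ Polynomial.X : ℝ) = ρ := by
  rw [← Polynomial.monomial_one_one_eq_X]
  refine (Polynomial.gaussNorm_monomial (NormedField.toAbsoluteValue K) ρ 1 1).trans ?_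
  change ‖(1 : K)‖ * ρ ^ 1 = ρ
  rw [norm_one, one_mul, pow_one]

theorem gaussVal_le_of_coeff {K : Type u} [NormedField K] [IsUltrametricDist K] {ρ : ℝ}
    (hρ : 0 < ρ) {p q : Polynomial K} (h : ∀ i, ‖p.coeff i‖ ≤ ‖q.coeff i‖) :
    gaussVal K ρ hρ p ≤ gaussVal K ρ hρ q := by
  obtain ⟨i, hi⟩ := p.exists_eq_gaussNorm (NormedField.toAbsoluteValue K) ρ
  change p.gaussNorm _ ρ ≤ q.gaussNorm _ ρ
  rw [hi]
  exact (mul_le_mul_of_nonneg_right (h i) (pow_nonneg hρ.le i)).trans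
    (q.le_gaussNorm (NormedField.toAbsoluteValue K) hρ.le i)

/-- The endomorphism of `K[X]` extending `s` and sending `X` to `c X`. -/
noncomputable def twist {K : Type u} [Field K] (s : K →+* K) (c : K) :
    Polynomial K →+* Polynomial K :=
  Polynomial.eval₂RingHom (Polynomial.C.comp s) (Polynomial.C c * Polynomial.X)

theorem coeff_twist {K : Type u} [Field K] (s : K →+* K) (c : K) (p : Polynomial K) (i : ℕ) :
    (twist s c p).coeff i = s (p.coeff i) * c ^ i := by
  induction p using Polynomial.induction_on' with
  | add p q hp hq => rw [map_add, Polynomial.coeff_add, hp, hq, Polynomial.coeff_add, map_add,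
      add_mul]
  | monomial n a =>
    rw [twist, Polynomial.coe_eval₂RingHom, Polynomial.eval₂_monomial, mul_pow, RingHom.comp_apply,
      ← Polynomial.C_pow, ← mul_assoc, ← Polynomial.C_mul, Polynomial.coeff_C_mul_X_pow,
      Polynomial.coeff_monomial]
    by_cases h : n = i
    · simp [h]
    · simp [h, Ne.symm h]

/-- Every metric valued field `K` has a complete extension with an element `t` of norm `ρ` such
that each isometric automorphism of `K` extends to an isometric automorphism multiplying `t` by
a prescribed scalar of norm `1`. -/
theorem exists_gauss_extension (K : Type u) [NormedField K] [IsUltrametricDist K] {ρ : ℝ}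
    (hρ : 0 < ρ) :
    ∃ (L : Type u) (_ : NormedField L) (_ : IsUltrametricDist L) (_ : CompleteSpace L)
      (j : K →+* L) (t : L), (∀ k, ‖j k‖ = ‖k‖) ∧ ‖t‖ = ρ ∧
      ∀ (s : K →+* K) (c : K), (∀ k, ‖s k‖ = ‖k‖) → Function.Surjective s → ‖c‖ = 1 →
        ∃ g : L →+* L, (∀ x, ‖g x‖ = ‖x‖) ∧ Function.Surjective g ∧
          (∀ k, g (j k) = j (s k)) ∧ g t = j c * t := by
  obtain ⟨L, _, _, _, ι, hι, hL⟩ := exists_complete_field (gaussVal K ρ hρ)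
  refine ⟨L, inferInstance, inferInstance, inferInstance, ι.comp Polynomial.C, ι Polynomial.X,
    fun k => ?_, ?_, fun s c hs hsurj hc => ?_⟩
  · rw [RingHom.comp_apply, hι, gaussVal_C]
  · rw [hι, gaussVal_X]
  · have hcoeff (p : Polynomial K) (i : ℕ) : ‖(twist s c p).coeff i‖ = ‖p.coeff i‖ := by
      rw [coeff_twist, norm_mul, norm_pow, hc, one_pow, mul_one, hs]
    obtain ⟨g, hg, hgι, hgs⟩ := hL (ι.comp (twist s c)) fun p => by
      rw [RingHom.comp_apply, hι]
      congr 1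
      exact le_antisymm (gaussVal_le_of_coeff hρ fun i => (hcoeff p i).le)
        (gaussVal_le_of_coeff hρ fun i => (hcoeff p i).ge)
    have hC (k : K) : g (ι (Polynomial.C k)) = ι (Polynomial.C (s k)) := by
      rw [hgι, RingHom.comp_apply, twist, Polynomial.coe_eval₂RingHom, Polynomial.eval₂_C,
        RingHom.comp_apply]
    have hX : g (ι Polynomial.X) = ι (Polynomial.C c) * ι Polynomial.X := by
      rw [hgι, RingHom.comp_apply, twist, Polynomial.coe_eval₂RingHom, Polynomial.eval₂_X, map_mul]
    refine ⟨g, hg, hgs fun p => ?_, hC, hX⟩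
    -- the range of `g` is a subring containing the constants and `X = c⁻¹ * g X`
    change ι p ∈ g.range
    have hCr (k : K) : ι (Polynomial.C k) ∈ g.range := by
      obtain ⟨k', rfl⟩ := hsurj k
      exact ⟨_, hC k'⟩
    have hXr : ι Polynomial.X ∈ g.range := by
      have hc0 : c ≠ 0 := by
        rintro rfl
        simp at hc
      have e : ι Polynomial.X = ι (Polynomial.C c⁻¹) * g (ι Polynomial.X) := by
        rw [hX, ← mul_assoc, ← map_mul, ← Polynomial.C_mul, inv_mul_cancel₀ hc0, Polynomial.C_1,
          map_one, one_mul]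
      rw [e]
      exact mul_mem (hCr _) ⟨_, rfl⟩
    induction p using Polynomial.induction_on' with
    | add p q hp hq => exact (map_add ι p q) ▸ add_mem hp hq
    | monomial n a =>
      rw [← Polynomial.C_mul_X_pow_eq_monomial, map_mul, map_pow]
      exact mul_mem (hCr a) (pow_mem hXr n)

/-! ### Multihomogeneous evaluation -/

section HomEval

variable {R : Type*} [CommRing R] {n : ℕ}

/-- The value of the homogenisation `P^h` at homogeneous coordinates `(x_i, y_i)`. -/
noncomputable def homEval (P : MvPolynomial (Fin n) ℤ) (x y : Fin n → R) : R :=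
  MvPolynomial.aeval (Sum.elim x y) (homogenize P)

theorem homEval_eq_sum_of_subset (P : MvPolynomial (Fin n) ℤ) {T : Finset (Fin n →₀ ℕ)}
    (hT : P.support ⊆ T) (x y : Fin n → R) :
    homEval P x y =
      ∑ s ∈ T, ((P.coeff s : ℤ) : R) * ∏ i, (x i ^ s i * y i ^ (P.degreeOf i - s i)) := by
  rw [← Finset.sum_subset hT fun s _ hs => by
    rw [MvPolynomial.notMem_support_iff.1 hs, Int.cast_zero, zero_mul]]
  simp [homEval, homogenize, map_sum, map_prod]

theorem homEval_eq_sum (P : MvPolynomial (Fin n) ℤ) (x y : Fin n → R) :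
    homEval P x y =
      ∑ s ∈ P.support, ((P.coeff s : ℤ) : R) * ∏ i, (x i ^ s i * y i ^ (P.degreeOf i - s i)) :=
  homEval_eq_sum_of_subset P subset_rfl x y

theorem homEval_mul (P : MvPolynomial (Fin n) ℤ) (c x y : Fin n → R) :
    homEval P (fun i => c i * x i) (fun i => c i * y i) =
      (∏ i, c i ^ P.degreeOf i) * homEval P x y := by
  rw [homEval_eq_sum, homEval_eq_sum, Finset.mul_sum]
  refine Finset.sum_congr rfl fun s hs => ?_
  have h : ∏ i, ((c i * x i) ^ s i * (c i * y i) ^ (P.degreeOf i - s i)) =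
      (∏ i, c i ^ P.degreeOf i) * ∏ i, (x i ^ s i * y i ^ (P.degreeOf i - s i)) := by
    rw [← Finset.prod_mul_distrib]
    refine Finset.prod_congr rfl fun i _ => ?_
    have := Nat.add_sub_cancel' (MvPolynomial.monomial_le_degreeOf i hs)
    conv_rhs => rw [← this, pow_add]
    rw [this]
    ring
  rw [h]
  ring

theorem homEval_one (P : MvPolynomial (Fin n) ℤ) (x : Fin n → R) :
    homEval P x (fun _ => 1) = MvPolynomial.aeval x P := by
  rw [homEval_eq_sum]
  conv_rhs => rw [MvPolynomial.as_sum P, map_sum]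
  refine Finset.sum_congr rfl fun s _ => ?_
  rw [MvPolynomial.aeval_monomial, Finsupp.prod_fintype _ _ (fun i => pow_zero _)]
  simp

theorem map_homEval {S : Type*} [CommRing S] (f : R →+* S) (P : MvPolynomial (Fin n) ℤ)
    (x y : Fin n → R) :
    f (homEval P x y) = homEval P (fun i => f (x i)) (fun i => f (y i)) := by
  simp only [homEval_eq_sum, map_sum, map_mul, map_prod, map_pow, map_intCast]

theorem homEval_C (z : ℤ) (x y : Fin n → R) : homEval (MvPolynomial.C z) x y = z := by
  have h : (MvPolynomial.C z : MvPolynomial (Fin n) ℤ).support ⊆ {0} :=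
    MvPolynomial.support_monomial_subset
  rw [homEval_eq_sum_of_subset _ h, Finset.sum_singleton, MvPolynomial.coeff_zero_C,
    Finset.prod_eq_one, mul_one]
  intro i _
  rw [MvPolynomial.degreeOf_C]
  simp

theorem homEval_X (i : Fin n) (x y : Fin n → R) : homEval (MvPolynomial.X i) x y = x i := by
  have h : (MvPolynomial.X i : MvPolynomial (Fin n) ℤ).support ⊆ {Finsupp.single i 1} :=
    MvPolynomial.support_monomial_subset
  rw [homEval_eq_sum_of_subset _ h, Finset.sum_singleton, MvPolynomial.coeff_X,
    if_pos rfl, Int.cast_one, one_mul, Finset.prod_eq_single i]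
  · simp
  · intro j _ hj
    simp [MvPolynomial.degreeOf_X, hj]
  · simp

/-- The polynomial `X_0 - X_1`, whose value is the distance. -/
noncomputable abbrev diffPoly : MvPolynomial (Fin 2) ℤ :=
  MvPolynomial.X 0 - MvPolynomial.X 1

/-- The polynomial `X_0 - X_1 X_2`, whose value at `(σ x, a, x)` measures the failure of
`σ x = a x`. -/
noncomputable abbrev scalePoly : MvPolynomial (Fin 3) ℤ :=
  MvPolynomial.X 0 - MvPolynomial.X 1 * MvPolynomial.X 2

theorem single_zero_ne_single_one :
    (Finsupp.single 0 1 : Fin 2 →₀ ℕ) ≠ Finsupp.single 1 1 := by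
  intro h
  simpa using DFunLike.congr_fun h 0

theorem coeff_diffPoly_zero : diffPoly.coeff (Finsupp.single 0 1) = 1 := by
  simp [diffPoly, MvPolynomial.coeff_X, single_zero_ne_single_one.symm]

theorem coeff_diffPoly_one : diffPoly.coeff (Finsupp.single 1 1) = -1 := by
  simp [diffPoly, MvPolynomial.coeff_X, single_zero_ne_single_one]

theorem degreeOf_diffPoly (i : Fin 2) : diffPoly.degreeOf i = 1 := by
  apply le_antisymm
  · refine (MvPolynomial.degreeOf_sub_le _ _ _).trans (max_le ?_ ?_) <;>
    · rw [MvPolynomial.degreeOf_X]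
      split_ifs <;> simp
  · have h0 := MvPolynomial.monomial_le_degreeOf i (f := diffPoly)
      (MvPolynomial.mem_support_iff.2 (coeff_diffPoly_zero ▸ one_ne_zero))
    have h1 := MvPolynomial.monomial_le_degreeOf i (f := diffPoly)
      (MvPolynomial.mem_support_iff.2 (by rw [coeff_diffPoly_one]; norm_num))
    fin_cases i
    · simpa using h0
    · simpa using h1

theorem homEval_diffPoly (x y : Fin 2 → R) :
    homEval diffPoly x y = x 0 * y 1 - y 0 * x 1 := by
  have h : diffPoly.support ⊆ {Finsupp.single 0 1, Finsupp.single 1 1} := by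
    classical
    refine (MvPolynomial.support_sub (Fin 2) _ _).trans (Finset.union_subset ?_ ?_)
    · exact MvPolynomial.support_monomial_subset.trans (by simp)
    · exact MvPolynomial.support_monomial_subset.trans (by simp)
  rw [homEval_eq_sum_of_subset _ h, Finset.sum_pair single_zero_ne_single_one,
    coeff_diffPoly_zero, coeff_diffPoly_one]
  simp only [degreeOf_diffPoly, Fin.prod_univ_two]
  simp
  ring

theorem single_ne_add :
    (Finsupp.single 0 1 : Fin 3 →₀ ℕ) ≠ Finsupp.single 1 1 + Finsupp.single 2 1 := by
  intro h
  simpa using DFunLike.congr_fun h 0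

theorem scalePoly_eq : scalePoly = MvPolynomial.monomial (Finsupp.single 0 1) 1 -
    MvPolynomial.monomial (Finsupp.single 1 1 + Finsupp.single 2 1) 1 := by
  rw [scalePoly, MvPolynomial.X, MvPolynomial.X, MvPolynomial.X, MvPolynomial.monomial_mul,
    one_mul]

theorem coeff_scalePoly_zero : scalePoly.coeff (Finsupp.single 0 1) = 1 := by
  rw [scalePoly_eq, MvPolynomial.coeff_sub, MvPolynomial.coeff_monomial,
    MvPolynomial.coeff_monomial, if_pos rfl, if_neg single_ne_add.symm, sub_zero]

theorem coeff_scalePoly_one :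
    scalePoly.coeff (Finsupp.single 1 1 + Finsupp.single 2 1) = -1 := by
  rw [scalePoly_eq, MvPolynomial.coeff_sub, MvPolynomial.coeff_monomial,
    MvPolynomial.coeff_monomial, if_pos rfl, if_neg single_ne_add, zero_sub]

theorem degreeOf_scalePoly (i : Fin 3) : scalePoly.degreeOf i = 1 := by
  apply le_antisymm
  · refine (MvPolynomial.degreeOf_sub_le _ _ _).trans (max_le ?_ ?_)
    · rw [MvPolynomial.degreeOf_X]
      split_ifs <;> simp
    · refine (MvPolynomial.degreeOf_mul_le _ _ _).trans ?_
      rw [MvPolynomial.degreeOf_X, MvPolynomial.degreeOf_X]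
      fin_cases i <;> simp
  · have h0 := MvPolynomial.monomial_le_degreeOf i (f := scalePoly)
      (MvPolynomial.mem_support_iff.2 (coeff_scalePoly_zero ▸ one_ne_zero))
    have h1 := MvPolynomial.monomial_le_degreeOf i (f := scalePoly)
      (MvPolynomial.mem_support_iff.2 (by rw [coeff_scalePoly_one]; norm_num))
    fin_cases i
    · simpa using h0
    · simpa using h1
    · simpa using h1

theorem homEval_scalePoly (x y : Fin 3 → R) :
    homEval scalePoly x y = x 0 * y 1 * y 2 - y 0 * x 1 * x 2 := by
  have h : scalePoly.support ⊆
      {Finsupp.single 0 1, Finsupp.single 1 1 + Finsupp.single 2 1} := by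
    classical
    rw [scalePoly_eq]
    refine (MvPolynomial.support_sub (Fin 3) _ _).trans (Finset.union_subset ?_ ?_)
    · exact MvPolynomial.support_monomial_subset.trans (by simp)
    · exact MvPolynomial.support_monomial_subset.trans (by simp)
  rw [homEval_eq_sum_of_subset _ h, Finset.sum_pair single_ne_add,
    coeff_scalePoly_zero, coeff_scalePoly_one]
  simp only [degreeOf_scalePoly, Fin.prod_univ_three]
  simp
  ring

end HomEval

/-! ### Projective lines with an isometric endomorphism -/

section ProjectiveLine

variable {K : Type u} [NormedField K]

theorem pval_eq_homEval {n : ℕ} (P : MvPolynomial (Fin n) ℤ) (a : Fin n → ℙ K (K × K)) :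
    pval P a = ‖homEval P (fun i => (nrep (a i)).1) (fun i => (nrep (a i)).2)‖ :=
  rfl

theorem exists_scale_normPair (v : K × K) (hv : v ≠ 0) :
    ∃ c : K, ‖c‖ = max ‖v.1‖ ‖v.2‖ ∧ v.1 = c * (normPair v).1 ∧ v.2 = c * (normPair v).2 := by
  rcases normPair_form v hv with ⟨h, -, -, -, e⟩ | ⟨h, -, -, -, e⟩
  · exact ⟨v.2, (max_eq_right h).symm, (congrArg Prod.fst e).symm, (congrArg Prod.snd e).symm⟩
  · exact ⟨v.1, (max_eq_left h.le).symm, (congrArg Prod.fst e).symm,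
      (congrArg Prod.snd e).symm⟩

/-- The value of a predicate in arbitrary homogeneous coordinates. -/
theorem pval_mk {n : ℕ} (P : MvPolynomial (Fin n) ℤ) (u : Fin n → K × K) (hu : ∀ i, u i ≠ 0) :
    pval P (fun i => Projectivization.mk K (u i) (hu i)) =
      ‖homEval P (fun i => (u i).1) (fun i => (u i).2)‖ /
        ∏ i, max ‖(u i).1‖ ‖(u i).2‖ ^ P.degreeOf i := by
  choose c hc h1 h2 using fun i => exists_scale_normPair (u i) (hu i)
  have e1 : (fun i => (u i).1) = fun i => c i * (normPair (u i)).1 := funext h1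
  have e2 : (fun i => (u i).2) = fun i => c i * (normPair (u i)).2 := funext h2
  have hpos (i : Fin n) : max ‖(u i).1‖ ‖(u i).2‖ ≠ 0 := by
    intro h
    have h1 : ‖(u i).1‖ = 0 := le_antisymm (h ▸ le_max_left _ _) (norm_nonneg _)
    have h2 : ‖(u i).2‖ = 0 := le_antisymm (h ▸ le_max_right _ _) (norm_nonneg _)
    exact hu i (Prod.ext (norm_eq_zero.1 h1) (norm_eq_zero.1 h2))
  rw [eq_div_iff (Finset.prod_ne_zero_iff.2 fun i _ => pow_ne_zero _ (hpos i)), e1, e2,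
    homEval_mul, norm_mul, norm_prod, pval_eq_homEval, mul_comm]
  simp only [nrep_mk, norm_pow, hc]

theorem pval_diffPoly (a b : ℙ K (K × K)) : pval diffPoly ![a, b] = pdist a b := by
  rw [pval_eq_homEval, homEval_diffPoly]
  rfl

theorem pval_C {n : ℕ} (z : ℤ) (a : Fin n → ℙ K (K × K)) :
    pval (MvPolynomial.C z) a = ‖(z : K)‖ := by
  rw [pval_eq_homEval, homEval_C]

theorem nrep_pinfty : nrep (pinfty : ℙ K (K × K)) = (1, 0) := by
  rw [pinfty, nrep_mk]
  simp [normPair]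

theorem pdist_pinfty (a : ℙ K (K × K)) : pdist a pinfty = ‖(nrep a).2‖ := by
  simp [pdist, nrep_pinfty]

theorem normPair_nrep (a : ℙ K (K × K)) : normPair (nrep a) = nrep a := by
  conv_rhs => rw [← mk_nrep a]
  rw [nrep_mk]

variable {K' : Type u} [NormedField K'] (s : K →+* K')

theorem map_pair_ne_zero {v : K × K} (hv : v ≠ 0) : (s v.1, s v.2) ≠ (0 : K' × K') := by
  intro h
  refine hv (Prod.ext (s.injective ?_) (s.injective ?_))
  · simpa using congrArg Prod.fst h
  · simpa using congrArg Prod.snd h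

/-- The map of projective lines induced by a field homomorphism. -/
noncomputable def mapPt (a : ℙ K (K × K)) : ℙ K' (K' × K') :=
  Projectivization.mk K' (s (nrep a).1, s (nrep a).2) (map_pair_ne_zero s (nrep_ne_zero a))

variable {s} (hs : ∀ x, ‖s x‖ = ‖x‖)
include hs

theorem normPair_map (v : K × K) :
    normPair (s v.1, s v.2) = (s (normPair v).1, s (normPair v).2) := by
  by_cases h : ‖v.1‖ ≤ ‖v.2‖
  · simp [normPair, hs, h]
  · simp [normPair, hs, h]

theorem nrep_mapPt (a : ℙ K (K × K)) : nrep (mapPt s a) = (s (nrep a).1, s (nrep a).2) := by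
  rw [mapPt, nrep_mk, normPair_map hs, normPair_nrep]

theorem mapPt_mk (v : K × K) (hv : v ≠ 0) :
    mapPt s (Projectivization.mk K v hv) =
      Projectivization.mk K' (s v.1, s v.2) (map_pair_ne_zero s hv) := by
  apply nrep_injective
  rw [nrep_mapPt hs, nrep_mk, nrep_mk, normPair_map hs]

theorem pdist_mapPt (a b : ℙ K (K × K)) : pdist (mapPt s a) (mapPt s b) = pdist a b := by
  rw [pdist, nrep_mapPt hs, nrep_mapPt hs, pdist, ← hs]
  simp only [map_sub, map_mul]

theorem pval_mapPt {n : ℕ} (P : MvPolynomial (Fin n) ℤ) (a : Fin n → ℙ K (K × K)) :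
    pval P (fun i => mapPt s (a i)) = pval P a := by
  rw [pval_eq_homEval, pval_eq_homEval, ← hs, map_homEval]
  simp only [nrep_mapPt hs]

theorem mapPt_pinfty : mapPt s (pinfty : ℙ K (K × K)) = pinfty := by
  apply nrep_injective
  rw [nrep_mapPt hs, nrep_pinfty, nrep_pinfty, map_one, map_zero]

theorem mapPt_surjective (h : Function.Surjective s) :
    Function.Surjective (mapPt s : ℙ K (K × K) → ℙ K' (K' × K')) := by
  intro b
  induction b using Projectivization.ind with
  | h v hv =>
    obtain ⟨v1, v2⟩ := v
    obtain ⟨x, rfl⟩ := h v1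
    obtain ⟨y, rfl⟩ := h v2
    have hne : ((x, y) : K × K) ≠ 0 := by
      rintro h0
      rw [Prod.mk_eq_zero] at h0
      exact hv (by simp [h0.1, h0.2])
    exact ⟨Projectivization.mk K (x, y) hne, mapPt_mk hs _ _⟩

end ProjectiveLine

section Structure

variable (K : Type u) [NormedField K] [IsUltrametricDist K] [CompleteSpace K]
  (s : K →+* K) (hs : ∀ x, ‖s x‖ = ‖x‖)

/-- The `LPσ`-structure on the projective line over `K` given by an isometric endomorphism. -/
noncomputable def projLineσ : Structure.{u} LPσ :=
  letI : MetricSpace (ℙ K (K × K)) := pmetric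
  { Carrier := ℙ K (K × K)
    metric := pmetric
    complete := pcomplete
    nonempty := ⟨pinfty⟩
    dist_le_one := pdist_le_one
    func := fun {_} f a => match f, a with
      | FuncPσ.infty, _ => pinfty
      | FuncPσ.sigma, a => mapPt s (a 0)
    rel := fun {_} P a => ⟨pval P a, norm_nonneg _, pval_le_one P a⟩
    func_unif := by
      intro n f ε h0 h1 x y h
      cases f with
      | infty => exact (dist_self _).trans_le h0.le
      | sigma => exact (pdist_mapPt hs _ _).trans_le (h 0).le
    rel_unif := by
      intro n P ε h0 h1 x y h
      exact pval_unif P ε h0 h1 x y h }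

theorem reduct_projLineσ : reduct (projLineσ K s hs) = projLine K := by
  unfold reduct projLine projLineσ
  congr
  funext n f a
  cases f
  rfl

variable {K s}

theorem models_projLineσ {a b : ℕ} (hK : HasCharPair K a b) (hsurj : Function.Surjective s) :
    Models (projLineσ K s hs) (MVFσ.{u} a b) := by
  rintro φ ((⟨φ, hφ, rfl⟩ | ⟨n, P, rfl⟩) | rfl | rfl)
  · rw [value_inclSentence, reduct_projLineσ]
    exact hφ K hK
  · rw [axiomII, value_supAll_eq_zero_iff]
    intro x
    refine Subtype.ext ?_
    change |pval P (fun i => x i) - pval P (fun i => mapPt s (x i))| = 0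
    have e := pval_mapPt hs P x
    exact abs_eq_zero.2 (sub_eq_zero.2 e.symm)
  · refine Subtype.ext ?_
    change pdist pinfty (mapPt s pinfty) = 0
    rw [mapPt_pinfty hs]
    exact (pmetric (K := K)).dist_self pinfty
  · rw [axiomIV, Sentence.value]
    refine (iSup_eq_zero_iff _).2 fun y => ?_
    obtain ⟨x, hx⟩ := mapPt_surjective hs hsurj y
    refine le_antisymm (iInf_le_of_le x ?_) bot_le
    change pval diffPoly _ ≤ 0
    have e : ∀ z : Fin 2 → ℙ K (K × K), z 0 = z 1 → pval diffPoly z ≤ 0 := by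
      intro z hz
      rw [pval_eq_homEval, homEval_diffPoly, hz, mul_comm, sub_self, norm_zero]
    refine e _ ?_
    exact hx

end Structure

/-! ### The valuation attached to a model, and the field it generates -/

section Points

variable {X : Type u} (o : X)

/-- The polynomial ring over `ℤ` generated by the points different from the base point `o`. -/
abbrev PointRing : Type u := MvPolynomial {m : X // m ≠ o} ℤ

open Classical in
/-- Homogeneous coordinates over `PointRing o` of the points of `X`: a point `m ≠ o` is
`[X_m : 1]`, and `o` is `[1 : 0]`. -/
noncomputable def coord (m : X) : PointRing o × PointRing o :=
  if h : m = o then (1, 0) else (MvPolynomial.X ⟨m, h⟩, 1)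

theorem coord_base : coord o o = (1, 0) := dif_pos rfl

theorem coord_of_ne {m : X} (h : m ≠ o) : coord o m = (MvPolynomial.X ⟨m, h⟩, 1) := dif_neg h

variable {K : Type u} [NormedField K] (φ : PointRing o →+* K)

theorem map_coord_ne_zero (m : X) : (φ (coord o m).1, φ (coord o m).2) ≠ (0 : K × K) := by
  by_cases h : m = o
  · subst h
    simp [coord_base]
  · simp [coord_of_ne o h]

/-- The points of `X` in the projective line over `K`, for a homomorphism `PointRing o → K`. -/
noncomputable def ptMap (m : X) : ℙ K (K × K) :=
  Projectivization.mk K (φ (coord o m).1, φ (coord o m).2) (map_coord_ne_zero o φ m)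

theorem ptMap_base : ptMap o φ o = pinfty := by
  simp only [ptMap, coord_base, map_one, map_zero]
  rfl

/-- The maximum of the norms of the homogeneous coordinates of a point. -/
noncomputable def coordMax (m : X) : ℝ := max ‖φ (coord o m).1‖ ‖φ (coord o m).2‖

theorem one_le_coordMax (m : X) : 1 ≤ coordMax o φ m := by
  by_cases h : m = o
  · subst h
    simp [coordMax, coord_base]
  · simp [coordMax, coord_of_ne o h]

theorem pval_ptMap {n : ℕ} (P : MvPolynomial (Fin n) ℤ) (m : Fin n → X) :
    pval P (fun i => ptMap o φ (m i)) =
      ‖φ (homEval P (fun i => (coord o (m i)).1) (fun i => (coord o (m i)).2))‖ /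
        ∏ i, coordMax o φ (m i) ^ P.degreeOf i := by
  simp only [ptMap]
  rw [pval_mk P (fun i => (φ (coord o (m i)).1, φ (coord o (m i)).2)), map_homEval]
  rfl

theorem pdist_ptMap_base {m : X} (h : m ≠ o) :
    pdist (ptMap o φ m) (ptMap o φ o) = (coordMax o φ m)⁻¹ := by
  obtain ⟨c, hc, -, h2⟩ := exists_scale_normPair _ (map_coord_ne_zero o φ m)
  rw [ptMap_base, pdist_pinfty, ptMap, nrep_mk]
  have h3 : φ (coord o m).2 = 1 := by rw [coord_of_ne o h, map_one]
  have h4 := congrArg norm h2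
  rw [norm_mul, hc] at h4
  simp only [h3, norm_one] at h4
  refine eq_inv_of_mul_eq_one_right ?_
  rw [coordMax]
  simp only [h3, norm_one]
  exact h4.symm

/-- The affine coordinates of a family of points, as a homomorphism on `PointRing o`. -/
noncomputable def affineHom (y : X → ℙ K (K × K)) : PointRing o →+* K :=
  (MvPolynomial.aeval fun m : {m : X // m ≠ o} => (nrep (y m.1)).1 / (nrep (y m.1)).2).toRingHom

theorem affineHom_X (y : X → ℙ K (K × K)) (m : {m : X // m ≠ o}) :
    affineHom o y (MvPolynomial.X m) = (nrep (y m.1)).1 / (nrep (y m.1)).2 :=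
  MvPolynomial.aeval_X _ _

theorem ptMap_affineHom {y : X → ℙ K (K × K)} (hy : y o = pinfty) {m : X}
    (hm : m = o ∨ (nrep (y m)).2 ≠ 0) : ptMap o (affineHom o y) m = y m := by
  rcases eq_or_ne m o with rfl | h
  · rw [ptMap_base, hy]
  · have h2 := hm.resolve_left h
    conv_rhs => rw [← mk_nrep (y m)]
    rw [ptMap, Projectivization.mk_eq_mk_iff']
    refine ⟨(nrep (y m)).2⁻¹, ?_⟩
    rw [coord_of_ne o h, affineHom_X, map_one]
    ext
    · simp [div_eq_inv_mul]
    · simp [h2]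

end Points

section Limit

variable {a b : ℕ} {M : Structure.{u} LP}
  {U : Ultrafilter (Sample.{u} a b M.Carrier (inftyOf M))}
  (hU : ∀ (n : ℕ) (P : MvPolynomial (Fin n) ℤ) (m : Fin n → M.Carrier),
    Tendsto (fun S : Sample.{u} a b M.Carrier (inftyOf M) => pval P fun i => S.pt (m i)) U
      (𝓝 (M.rel (n := n) P m : ℝ)))

/-- In every model, the distance is the predicate `‖X_0 - X_1‖`. -/
theorem dist_eq_rel_diffPoly (hM : Models M (MVF.{u} a b)) (x y : M.Carrier) :
    dist x y = (M.rel (n := 2) diffPoly ![x, y] : ℝ) := by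
  let φ : Formula LP 2 := Formula.eq (.dist (.var 0) (.var 1))
    (.rel (L := LP) (k := 2) diffPoly fun i => .var i)
  have hφ : φ.supAll ∈ MVF.{u} a b := by
    intro K _ _ _ _
    rw [value_supAll_eq_zero_iff]
    intro z
    refine Subtype.ext (abs_eq_zero.2 (sub_eq_zero.2 ?_))
    exact (congrArg (pval diffPoly) (by ext i; fin_cases i <;> rfl)).trans
      (pval_diffPoly (z 0) (z 1)) |>.symm
  have h := (value_supAll_eq_zero_iff M φ).1 (hM _ hφ) ![x, y]
  have h2 := sub_eq_zero.1 (abs_eq_zero.1 (congrArg Subtype.val h))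
  exact h2

include hU

theorem tendsto_pdist (hM : Models M (MVF.{u} a b)) (x y : M.Carrier) :
    Tendsto (fun S : Sample.{u} a b M.Carrier (inftyOf M) => pdist (S.pt x) (S.pt y)) U
      (𝓝 (dist x y)) := by
  rw [dist_eq_rel_diffPoly hM]
  refine (hU 2 diffPoly ![x, y]).congr fun S => ?_
  rw [← pval_diffPoly]
  congr 1
  ext i
  fin_cases i <;> rfl

/-- The affine coordinate homomorphism of a sample. -/
noncomputable abbrev sampleHom (S : Sample.{u} a b M.Carrier (inftyOf M)) :
    PointRing (inftyOf M) →+* S.K :=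
  affineHom (inftyOf M) S.pt

theorem eventually_norm_sampleHom_le (hM : Models M (MVF.{u} a b))
    (F : PointRing (inftyOf M)) :
    ∃ C : ℝ, ∀ᶠ S in (U : Filter (Sample.{u} a b M.Carrier (inftyOf M))),
      ‖sampleHom S F‖ ≤ C := by
  induction F using MvPolynomial.induction_on with
  | C z =>
    refine ⟨1, Eventually.of_forall fun S => ?_⟩
    have : sampleHom S (MvPolynomial.C z) = (z : S.K) := by simp
    rw [this]
    exact IsUltrametricDist.norm_intCast_le_one S.K z
  | add p q hp hq =>
    obtain ⟨C, hC⟩ := hp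
    obtain ⟨D, hD⟩ := hq
    refine ⟨C + D, ?_⟩
    filter_upwards [hC, hD] with S h1 h2
    rw [map_add]
    exact (norm_add_le _ _).trans (add_le_add h1 h2)
  | mul_X p m hp =>
    obtain ⟨C, hC⟩ := hp
    have hpos : 0 < dist m.1 (inftyOf M) := dist_pos.2 m.2
    refine ⟨C * (2 / dist m.1 (inftyOf M)), ?_⟩
    filter_upwards [hC, (tendsto_pdist hU hM m.1 (inftyOf M)).eventually_const_lt
      (half_lt_self hpos)] with S h1 h2
    rw [S.pt_base, pdist_pinfty] at h2
    rw [map_mul, norm_mul]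
    refine mul_le_mul h1 ?_ (norm_nonneg _) ((norm_nonneg _).trans h1)
    rw [affineHom_X, norm_div, div_le_div_iff₀ (by linarith) hpos]
    nlinarith [nrep_fst_le (S.pt m.1), norm_nonneg (nrep (S.pt m.1)).1]

theorem exists_tendsto_norm_sampleHom (hM : Models M (MVF.{u} a b))
    (F : PointRing (inftyOf M)) :
    ∃ r : ℝ≥0, Tendsto (fun S : Sample.{u} a b M.Carrier (inftyOf M) => ‖sampleHom S F‖₊) U
      (𝓝 r) := by
  obtain ⟨C, hC⟩ := eventually_norm_sampleHom_le hU hM F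
  have hcpt : IsCompact (Set.Iic C.toNNReal) := by
    rw [← Set.Icc_bot]
    exact isCompact_Icc
  obtain ⟨r, -, hr⟩ := hcpt.ultrafilter_le_nhds
    (U.map fun S : Sample.{u} a b M.Carrier (inftyOf M) => ‖sampleHom S F‖₊) (by
      rw [le_principal_iff, Ultrafilter.coe_map, mem_map]
      filter_upwards [hC] with S hS
      exact NNReal.coe_le_coe.1 (by
        rw [coe_nnnorm]
        exact hS.trans (Real.le_coe_toNNReal C)))
  exact ⟨r, hr⟩

/-- The valuation on `PointRing` which is the limit of the norms in the samples. -/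
theorem exists_limit_valuation (hM : Models M (MVF.{u} a b)) :
    ∃ v : Valuation (PointRing (inftyOf M)) ℝ≥0, ∀ F,
      Tendsto (fun S : Sample.{u} a b M.Carrier (inftyOf M) => ‖sampleHom S F‖₊) U
        (𝓝 (v F)) := by
  choose v hv using exists_tendsto_norm_sampleHom hU hM
  refine ⟨{ toFun := v, map_zero' := ?_, map_one' := ?_, map_mul' := ?_, map_add_le_max' := ?_ },
    hv⟩
  · refine tendsto_nhds_unique (hv 0) ?_
    simp
  · refine tendsto_nhds_unique (hv 1) ?_
    simp
  · intro F G
    refine tendsto_nhds_unique (hv (F * G)) ?_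
    simpa using (hv F).mul (hv G)
  · intro F G
    refine le_of_tendsto_of_tendsto' (hv (F + G)) ((hv F).max (hv G)) fun S => ?_
    rw [map_add]
    exact IsUltrametricDist.norm_add_le_max _ _

variable {v : Valuation (PointRing (inftyOf M)) ℝ≥0}
  (hv : ∀ F, Tendsto (fun S : Sample.{u} a b M.Carrier (inftyOf M) => ‖sampleHom S F‖₊) U
    (𝓝 (v F)))
  {L : Type u} [NormedField L] {ι : PointRing (inftyOf M) →+* L}
  (hι : ∀ F, ‖ι F‖ = v F)

omit hU in
include hv hι in
theorem tendsto_norm_sampleHom (F : PointRing (inftyOf M)) :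
    Tendsto (fun S : Sample.{u} a b M.Carrier (inftyOf M) => ‖sampleHom S F‖) U (𝓝 ‖ι F‖) := by
  rw [hι]
  exact (NNReal.continuous_coe.tendsto _).comp (hv F)

include hv hι

/-- The points of the model, placed in the projective line over a field with the limit
valuation, have the predicates of the model. -/
theorem pval_ptMap_eq_rel (hM : Models M (MVF.{u} a b)) {n : ℕ} (P : MvPolynomial (Fin n) ℤ)
    (m : Fin n → M.Carrier) :
    pval P (fun i => ptMap (inftyOf M) ι (m i)) = (M.rel (n := n) P m : ℝ) := by
  refine tendsto_nhds_unique ?_ (hU n P m)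
  rw [pval_ptMap]
  have h1 : Tendsto (fun S : Sample.{u} a b M.Carrier (inftyOf M) =>
      pval P fun i => ptMap (inftyOf M) (sampleHom S) (m i)) U
      (𝓝 (‖ι (homEval P (fun i => (coord (inftyOf M) (m i)).1)
        (fun i => (coord (inftyOf M) (m i)).2))‖ /
        ∏ i, coordMax (inftyOf M) ι (m i) ^ P.degreeOf i)) := by
    simp only [pval_ptMap]
    refine (tendsto_norm_sampleHom hv hι _).div (tendsto_finsetProd _ fun i _ => ?_) ?_
    · exact ((tendsto_norm_sampleHom hv hι _).max (tendsto_norm_sampleHom hv hι _)).pow _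
    · exact Finset.prod_ne_zero_iff.2 fun i _ => pow_ne_zero _
        (zero_lt_one.trans_le (one_le_coordMax _ _ _)).ne'
  refine h1.congr' ?_
  have h2 : ∀ i, ∀ᶠ S in (U : Filter (Sample.{u} a b M.Carrier (inftyOf M))),
      ptMap (inftyOf M) (sampleHom S) (m i) = S.pt (m i) := by
    intro i
    by_cases h : m i = inftyOf M
    · exact Eventually.of_forall fun S => ptMap_affineHom _ S.pt_base (Or.inl h)
    · filter_upwards [(tendsto_pdist hU hM (m i) (inftyOf M)).eventually_const_lt
        (dist_pos.2 h)] with S hS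
      rw [S.pt_base, pdist_pinfty] at hS
      exact ptMap_affineHom _ S.pt_base (Or.inr (norm_pos_iff.1 hS))
  filter_upwards [eventually_all.2 h2] with S hS
  simp only [hS]

theorem pdist_ptMap_eq_dist (hM : Models M (MVF.{u} a b)) (x y : M.Carrier) :
    pdist (ptMap (inftyOf M) ι x) (ptMap (inftyOf M) ι y) = dist x y := by
  rw [dist_eq_rel_diffPoly hM, ← pval_ptMap_eq_rel hU hv hι hM, ← pval_diffPoly]
  congr 1
  ext i
  fin_cases i <;> rfl

theorem coordMax_eq (hM : Models M (MVF.{u} a b)) {m : M.Carrier} (h : m ≠ inftyOf M) :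
    coordMax (inftyOf M) ι m = (dist m (inftyOf M))⁻¹ := by
  rw [← pdist_ptMap_eq_dist hU hv hι hM, pdist_ptMap_base _ _ h, inv_inv]

/-- The limit valuation is determined by the predicates of the model. -/
theorem valuation_rename (hM : Models M (MVF.{u} a b)) {n : ℕ} (P : MvPolynomial (Fin n) ℤ)
    (m : Fin n → {m : M.Carrier // m ≠ inftyOf M}) :
    (v (MvPolynomial.rename m P) : ℝ) = (M.rel (n := n) P fun i => (m i).1 : ℝ) *
      ∏ i, (dist (m i).1 (inftyOf M))⁻¹ ^ P.degreeOf i := by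
  have h := pval_ptMap (inftyOf M) ι P fun i => (m i).1
  rw [pval_ptMap_eq_rel hU hv hι hM] at h
  have e : homEval P (fun i => (coord (inftyOf M) (m i).1).1)
      (fun i => (coord (inftyOf M) (m i).1).2) = MvPolynomial.rename m P := by
    simp only [coord_of_ne _ (m _).2]
    refine (homEval_one (R := PointRing (inftyOf M)) P fun i => MvPolynomial.X (m i)).trans ?_
    clear h
    induction P using MvPolynomial.induction_on with
    | C z => simp
    | add p q hp hq => rw [map_add, map_add, hp, hq]
    | mul_X p i hp => rw [map_mul, map_mul, hp, MvPolynomial.aeval_X, MvPolynomial.rename_X]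
  rw [e, eq_div_iff (Finset.prod_ne_zero_iff.2 fun i _ => pow_ne_zero _
    (zero_lt_one.trans_le (one_le_coordMax _ _ _)).ne')] at h
  rw [← hι, ← h]
  congr 1
  exact Finset.prod_congr rfl fun i _ => by rw [coordMax_eq hU hv hι hM (m i).2]

/-- The limit valuation is invariant under maps preserving the predicates. -/
theorem valuation_rename_eq (hM : Models M (MVF.{u} a b)) {θ : M.Carrier → M.Carrier}
    (hrel : ∀ (n : ℕ) (P : MvPolynomial (Fin n) ℤ) (m : Fin n → M.Carrier),
      M.rel (n := n) P (fun i => θ (m i)) = M.rel (n := n) P m)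
    (hdist : ∀ m, dist (θ m) (inftyOf M) = dist m (inftyOf M))
    (hne : ∀ m, m ≠ inftyOf M → θ m ≠ inftyOf M) (F : PointRing (inftyOf M)) :
    v (MvPolynomial.rename (fun m : {m : M.Carrier // m ≠ inftyOf M} =>
      (⟨θ m.1, hne m.1 m.2⟩ : {m : M.Carrier // m ≠ inftyOf M})) F) = v F := by
  obtain ⟨n, m, -, P, rfl⟩ := MvPolynomial.exists_fin_rename F
  apply NNReal.eq
  rw [MvPolynomial.rename_rename, valuation_rename hU hv hι hM, valuation_rename hU hv hι hM]
  simp only [Function.comp_apply, hdist, hrel n P fun i => (m i).1]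

end Limit

/-! ### Models as substructures of projective lines -/

section Models

variable {a b : ℕ} {N : Structure.{u} LPσ}

/-- The interpretation of `σ`. -/
def sigmaOf (N : Structure.{u} LPσ) (x : N.Carrier) : N.Carrier :=
  N.func (n := 1) FuncPσ.sigma ![x]

theorem func_sigma (x : Fin 1 → N.Carrier) :
    N.func (n := 1) FuncPσ.sigma x = sigmaOf N (x 0) :=
  congrArg _ (by ext i; fin_cases i; rfl)

theorem models_reduct (hN : Models N (MVFσ.{u} a b)) : Models (reduct N) (MVF.{u} a b) :=
  fun φ hφ => (value_inclSentence N φ).symm.trans (hN _ (Or.inl (Or.inl ⟨φ, hφ, rfl⟩)))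

theorem rel_sigma (hN : Models N (MVFσ.{u} a b)) {n : ℕ} (P : MvPolynomial (Fin n) ℤ)
    (x : Fin n → N.Carrier) : N.rel (n := n) P (fun i => sigmaOf N (x i)) = N.rel (n := n) P x := by
  have h := (value_supAll_eq_zero_iff N _).1 (hN _ (Or.inl (Or.inr ⟨n, P, rfl⟩))) x
  have h2 := sub_eq_zero.1 (abs_eq_zero.1 (congrArg Subtype.val h))
  refine Eq.trans ?_ (Subtype.ext h2 : N.rel (n := n) P _ = N.rel (n := n) P _).symm
  congr 1
  ext i
  simp only [sigmaT, Term.eval, func_sigma]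
  rfl

theorem dist_eq_rel (hN : Models N (MVFσ.{u} a b)) (x y : N.Carrier) :
    dist x y = (N.rel (n := 2) diffPoly ![x, y] : ℝ) :=
  dist_eq_rel_diffPoly (models_reduct hN) x y

theorem isometry_sigma (hN : Models N (MVFσ.{u} a b)) : Isometry (sigmaOf N) :=
  Isometry.of_dist_eq fun x y => by
    rw [dist_eq_rel hN, dist_eq_rel hN, ← rel_sigma hN diffPoly ![x, y]]
    congr 2
    ext i
    fin_cases i <;> rfl

theorem sigma_infty (hN : Models N (MVFσ.{u} a b)) :
    sigmaOf N (inftyOf (reduct N)) = inftyOf (reduct N) := by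
  have h := hN axiomIII (Or.inr (Or.inl rfl))
  have h2 := dist_eq_zero.1 (congrArg Subtype.val h)
  simp only [inftyT, sigmaT, Term.eval, func_sigma] at h2
  refine Eq.trans ?_ (h2.symm.trans ?_)
  · exact congrArg _ (congrArg _ (Subsingleton.elim _ _))
  · exact congrArg _ (Subsingleton.elim _ _)

theorem sigma_surjective (hN : Models N (MVFσ.{u} a b)) :
    Function.Surjective (sigmaOf N) := by
  intro y
  have hcl : IsClosed (Set.range (sigmaOf N)) :=
    (isometry_sigma hN).isClosedEmbedding.isClosed_range
  rw [← Set.mem_range, ← hcl.closure_eq, Metric.mem_closure_range_iff]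
  intro ε hε
  have h := (iSup_eq_zero_iff _).1 (hN axiomIV (Or.inr (Or.inr rfl))) y
  obtain ⟨x, hx⟩ := exists_le_iInf_add (fun x : N.Carrier =>
    N.rel (n := 2) diffPoly ![sigmaOf N x, y]) (half_pos hε)
  refine ⟨x, ?_⟩
  rw [dist_comm, dist_eq_rel hN]
  have h0 : (⨅ x : N.Carrier, N.rel (n := 2) diffPoly ![sigmaOf N x, y]) = 0 := by
    rw [← h]
    refine iInf_congr fun x => ?_
    simp only [normF, Formula.eval]
    congr 1
    ext i
    fin_cases i
    · simp [sigmaT, Term.eval, func_sigma]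
      rfl
    · rfl
  rw [h0] at hx
  have : ((0 : I) : ℝ) = 0 := rfl
  linarith

end Models

section Extension

variable {a b : ℕ} {N N' : Structure.{u} LPσ}

theorem embedding_infty {f : N.Carrier → N'.Carrier} (hf : IsEmbedding N N' f) :
    f (inftyOf (reduct N)) = inftyOf (reduct N') :=
  (hf.map_func (n := 0) FuncPσ.infty Fin.elim0).trans
    (congrArg (N'.func (n := 0) FuncPσ.infty) (Subsingleton.elim _ _))

theorem embedding_sigma {f : N.Carrier → N'.Carrier} (hf : IsEmbedding N N' f) (x : N.Carrier) :
    f (sigmaOf N x) = sigmaOf N' (f x) :=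
  (hf.map_func (n := 1) FuncPσ.sigma ![x]).trans (func_sigma _)

theorem coord_rename {X : Type u} {o : X} {θ : X → X} (ho : θ o = o)
    (hne : ∀ m, m ≠ o → θ m ≠ o) (m : X) :
    coord o (θ m) =
      (MvPolynomial.rename (fun m : {m : X // m ≠ o} =>
        (⟨θ m.1, hne m.1 m.2⟩ : {m : X // m ≠ o})) (coord o m).1,
      MvPolynomial.rename (fun m : {m : X // m ≠ o} =>
        (⟨θ m.1, hne m.1 m.2⟩ : {m : X // m ≠ o})) (coord o m).2) := by
  by_cases h : m = o
  · subst h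
    rw [ho, coord_base, map_one, map_zero]
  · rw [coord_of_ne o h, coord_of_ne o (hne m h), map_one, MvPolynomial.rename_X]

/-- A model of `MVF a b` with a bijection `θ` preserving the predicates embeds equivariantly into
a genuine projective line with an isometric automorphism `τ`, in which moreover the equation
`τ x = α x` has a solution `x` of norm `1`, for a prescribed `α` of norm `1` in the model. -/
theorem exists_extension_of_bijection {M : Structure.{u} LP} (hM : Models M (MVF.{u} a b))
    (θ : M.Carrier → M.Carrier) (hθ : Isometry θ) (hθo : θ (inftyOf M) = inftyOf M)
    (hθs : Function.Surjective θ)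
    (hrel : ∀ (n : ℕ) (P : MvPolynomial (Fin n) ℤ) (m : Fin n → M.Carrier),
      M.rel (n := n) P (fun i => θ (m i)) = M.rel (n := n) P m)
    (α : M.Carrier) (h1 : (M.rel (n := 1) (MvPolynomial.X 0) (fun _ => α) : ℝ) = 1)
    (h2 : dist α (inftyOf M) = 1) :
    ∃ (L : Type u) (_ : NormedField L) (_ : IsUltrametricDist L) (_ : CompleteSpace L)
      (τ : L →+* L) (f : M.Carrier → ℙ L (L × L)) (x : ℙ L (L × L)),
      (∀ x, ‖τ x‖ = ‖x‖) ∧ Function.Surjective τ ∧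
      (∀ x y, pdist (f x) (f y) = dist x y) ∧ f (inftyOf M) = pinfty ∧
      (∀ m, f (θ m) = mapPt τ (f m)) ∧
      (∀ (n : ℕ) (P : MvPolynomial (Fin n) ℤ) (m : Fin n → M.Carrier),
        pval P (fun i => f (m i)) = M.rel (n := n) P m) ∧
      pval scalePoly ![mapPt τ x, f α, x] = 0 ∧ ‖(nrep x).1‖ = 1 ∧ ‖(nrep x).2‖ = 1 := by
  obtain ⟨U, hU⟩ := exists_ultrafilter_sample M hM
  obtain ⟨v, hv⟩ := exists_limit_valuation hU hM
  obtain ⟨K, _, _, _, ι, hι, hK⟩ := exists_complete_field v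
  have hne : ∀ m, m ≠ inftyOf M → θ m ≠ inftyOf M := fun m hm h =>
    hm (hθ.injective (h.trans hθo.symm))
  let A : PointRing (inftyOf M) →+* PointRing (inftyOf M) :=
    (MvPolynomial.rename (fun m : {m : M.Carrier // m ≠ inftyOf M} =>
      (⟨θ m.1, hne m.1 m.2⟩ : {m : M.Carrier // m ≠ inftyOf M}))).toRingHom
  have hAs : Function.Surjective A := by
    refine MvPolynomial.rename_surjective _ ?_
    rintro ⟨m, hm⟩
    obtain ⟨m', rfl⟩ := hθs m
    refine ⟨⟨m', ?_⟩, rfl⟩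
    rintro rfl
    exact hm hθo
  have hA : ∀ F, v (A F) = v F :=
    valuation_rename_eq hU hv hι hM hrel (fun m => by
      conv_lhs => rw [← hθo]
      exact hθ.dist_eq m _) hne
  have hAcoord (m : M.Carrier) : coord (inftyOf M) (θ m) =
      (A (coord (inftyOf M) m).1, A (coord (inftyOf M) m).2) := coord_rename hθo hne m
  obtain ⟨s, hs, hsι, hssurj⟩ := hK (ι.comp A) fun F => by rw [RingHom.comp_apply, hι, hA]
  have hs_surj : Function.Surjective s := by
    refine hssurj fun F => ?_
    obtain ⟨G, rfl⟩ := hAs F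
    exact ⟨ι G, hsι G⟩
  have hαo : α ≠ inftyOf M := by
    rintro rfl
    rw [dist_self] at h2
    exact zero_ne_one h2
  let c : K := ι (MvPolynomial.X ⟨α, hαo⟩)
  have hc : ‖c‖ = 1 := by
    have e2 := pval_ptMap_eq_rel hU hv hι hM (n := 1) (MvPolynomial.X 0) fun _ => α
    rw [pval_ptMap, homEval_X, coordMax_eq hU hv hι hM hαo, h1, h2] at e2
    simpa [coord_of_ne _ hαo] using e2
  obtain ⟨L, _, _, _, j, t, hj, ht, hL⟩ := exists_gauss_extension K one_pos
  obtain ⟨τ, hτ, hτsurj, hτj, hτt⟩ := hL s c hs hs_surj hc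
  have hjι : ∀ F, ‖(j.comp ι) F‖ = v F := fun F => by rw [RingHom.comp_apply, hj, hι]
  have hτι : ∀ F, τ (j.comp ι F) = j.comp ι (A F) := fun F => by
    rw [RingHom.comp_apply, hτj, hsι]
    rfl
  have ht1 : ((t, 1) : L × L) ≠ 0 := by simp
  refine ⟨L, inferInstance, inferInstance, inferInstance, τ, ptMap (inftyOf M) (j.comp ι),
    Projectivization.mk L (t, 1) ht1, hτ, hτsurj, pdist_ptMap_eq_dist hU hv hjι hM,
    ptMap_base _ _, fun m => ?_, fun n P m => pval_ptMap_eq_rel hU hv hjι hM P m, ?_, ?_, ?_⟩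
  · simp only [ptMap, mapPt_mk hτ, hAcoord, hτι]
  · have e : (![mapPt τ (Projectivization.mk L (t, 1) ht1), ptMap (inftyOf M) (j.comp ι) α,
        Projectivization.mk L (t, 1) ht1] : Fin 3 → ℙ L (L × L)) =
        fun i => Projectivization.mk L ((![(j c * t, 1), (j c, 1), (t, 1)] : Fin 3 → L × L) i)
          (by fin_cases i <;> simp) := by
      ext i
      fin_cases i
      · simp [mapPt_mk hτ, hτt]
      · simp [ptMap, coord_of_ne _ hαo, c]
      · simp
    rw [e, pval_mk, homEval_scalePoly]
    simp
  · rw [nrep_mk]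
    simp [normPair, ht]
  · rw [nrep_mk]
    simp [normPair, ht]

/-- `exists_extension_of_bijection` for the bijection `σ` of a model of `MVFσ a b`. -/
theorem exists_extension_solving (hN : Models N (MVFσ.{u} a b)) (α : N.Carrier)
    (h1 : (N.rel (n := 1) (MvPolynomial.X 0 : MvPolynomial (Fin 1) ℤ) (fun _ => α) : ℝ) = 1)
    (h2 : dist α (inftyOf (reduct N)) = 1) :
    ∃ (L : Type u) (_ : NormedField L) (_ : IsUltrametricDist L) (_ : CompleteSpace L)
      (τ : L →+* L) (hτ : ∀ x, ‖τ x‖ = ‖x‖) (f : N.Carrier → ℙ L (L × L)) (x : ℙ L (L × L)),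
      Function.Surjective τ ∧ IsEmbedding N (projLineσ L τ hτ) f ∧
      pval scalePoly ![mapPt τ x, f α, x] = 0 ∧ ‖(nrep x).1‖ = 1 ∧ ‖(nrep x).2‖ = 1 := by
  obtain ⟨L, _, _, _, τ, f, x, hτ, hτs, hd, ho, hσ, hP, hx⟩ :=
    exists_extension_of_bijection (models_reduct hN) (sigmaOf N) (isometry_sigma hN)
      (sigma_infty hN) (sigma_surjective hN) (fun n P m => rel_sigma hN P m) α h1 h2
  refine ⟨L, inferInstance, inferInstance, inferInstance, τ, hτ, f, x, hτs, ⟨hd, ?_, ?_⟩, hx⟩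
  · intro n g y
    cases g with
    | infty => exact (congrArg f (func_infty (reduct N) y)).trans ho
    | sigma => exact (congrArg f (func_sigma y)).trans (hσ (y 0))
  · exact fun {n} P y => Subtype.ext (hP n P y)

end Extension

/-! ### The formula `inf_x ‖σ x - α x‖` over elements of norm `1` -/

section ScaleFormula

/-- The connective `max(t_0, 1 - t_1, 1 - t_2)`. -/
def scaleConn : C(Fin 3 → I, I) where
  toFun t := max (t 0) (max (σ (t 1)) (σ (t 2)))
  continuous_toFun := by fun_prop

/-- The formula, in the variable `α`, which measures how well `σ x = α x` can be solved with
`‖x‖ = 1` and `d(x, ∞) = 1`. -/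
noncomputable def scaleFormula : Formula LPσ 1 :=
  .inf (.conn scaleConn ![normF scalePoly ![sigmaT (.var 1), .var 0, .var 1],
    normF (MvPolynomial.X 0 : MvPolynomial (Fin 1) ℤ) (fun _ => .var 1),
    .dist (.var 1) inftyT])

/-- The value of the matrix of `scaleFormula`. -/
noncomputable def scaleBody (N : Structure.{u} LPσ) (α x : N.Carrier) : I :=
  max (N.rel (n := 3) scalePoly ![sigmaOf N x, α, x])
    (max (σ (N.rel (n := 1) (MvPolynomial.X 0 : MvPolynomial (Fin 1) ℤ) fun _ => x))
      (σ ⟨dist x (inftyOf (reduct N)), dist_nonneg, N.dist_le_one _ _⟩))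

theorem scaleFormula_eval (N : Structure.{u} LPσ) (v : Fin 1 → N.Carrier) :
    scaleFormula.eval N v = ⨅ x, scaleBody N (v 0) x := by
  refine iInf_congr fun x => ?_
  have e0 : (Fin.snoc (α := fun _ => N.Carrier) v x) 0 = v 0 := rfl
  have e1 : (Fin.snoc (α := fun _ => N.Carrier) v x) 1 = x := rfl
  simp only [Formula.eval, scaleConn, ContinuousMap.coe_mk, scaleBody]
  congr 1
  · simp only [normF, Matrix.cons_val_zero, Formula.eval]
    congr 1
    ext i
    fin_cases i
    · simp only [sigmaT, Fin.zero_eta, Matrix.cons_val_zero, Term.eval, func_sigma]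
      rfl
    · rfl
    · rfl
  · congr 2
    refine Subtype.ext ?_
    change dist (Fin.snoc (α := fun _ => N.Carrier) v x 1) (N.func (n := 0) FuncPσ.infty _) = _
    rw [e1]
    exact congrArg _ (func_infty (reduct N) _)

theorem scaleBody_embedding {N N' : Structure.{u} LPσ} {f : N.Carrier → N'.Carrier}
    (hf : IsEmbedding N N' f) (α x : N.Carrier) :
    scaleBody N' (f α) (f x) = scaleBody N α x := by
  rw [scaleBody, scaleBody]
  congr 1
  · rw [← hf.map_rel (n := 3) scalePoly, ← embedding_sigma hf]
    congr 1
    ext i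
    fin_cases i <;> rfl
  · congr 2
    · exact hf.map_rel (n := 1) (MvPolynomial.X 0 : MvPolynomial (Fin 1) ℤ) fun _ => x
    · refine Subtype.ext ?_
      change dist (f x) _ = _
      rw [← embedding_infty hf]
      exact hf.isometry _ _

theorem scaleBody_eq_zero {N : Structure.{u} LPσ} {α x : N.Carrier}
    (h0 : N.rel (n := 3) scalePoly ![sigmaOf N x, α, x] = 0)
    (h1 : N.rel (n := 1) (MvPolynomial.X 0 : MvPolynomial (Fin 1) ℤ) (fun _ => x) = 1)
    (h2 : dist x (inftyOf (reduct N)) = 1) : scaleBody N α x = 0 := by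
  have h3 : (⟨dist x (inftyOf (reduct N)), dist_nonneg, N.dist_le_one _ _⟩ : I) = 1 :=
    Subtype.ext h2
  rw [scaleBody, h0, h1, h3]
  simp

variable {a b : ℕ}

/-- The ultrametric inequality for `y - α x`, in homogeneous coordinates, holds in all models. -/
theorem mul_le_max_scalePoly {M : Structure.{u} LP} (hM : Models M (MVF.{u} a b))
    (y α x : M.Carrier) :
    (M.rel (n := 1) (MvPolynomial.X 0) (fun _ => y) : ℝ) * dist α (inftyOf M) *
        dist x (inftyOf M) ≤
      max (M.rel (n := 3) scalePoly ![y, α, x] : ℝ)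
        (dist y (inftyOf M) * (M.rel (n := 1) (MvPolynomial.X 0) (fun _ => α) : ℝ) *
          (M.rel (n := 1) (MvPolynomial.X 0) (fun _ => x) : ℝ)) := by
  obtain ⟨U, hU⟩ := exists_ultrafilter_sample M hM
  have hX (z : M.Carrier) := hU 1 (MvPolynomial.X 0) fun _ => z
  have hd (z : M.Carrier) := tendsto_pdist hU hM z (inftyOf M)
  refine le_of_tendsto_of_tendsto' (((hX y).mul (hd α)).mul (hd x))
    ((hU 3 scalePoly ![y, α, x]).max (((hd y).mul (hX α)).mul (hX x))) fun S => ?_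
  simp only [pval_eq_homEval, homEval_X, homEval_scalePoly, S.pt_base, pdist_pinfty, ← norm_mul]
  have e : (nrep (S.pt y)).1 * (nrep (S.pt α)).2 * (nrep (S.pt x)).2 =
      ((nrep (S.pt y)).1 * (nrep (S.pt α)).2 * (nrep (S.pt x)).2 -
        (nrep (S.pt y)).2 * (nrep (S.pt α)).1 * (nrep (S.pt x)).1) +
      (nrep (S.pt y)).2 * (nrep (S.pt α)).1 * (nrep (S.pt x)).1 := by ring
  conv_lhs => rw [e]
  exact IsUltrametricDist.norm_add_le_max _ _

/-- If `‖α‖ < 1` then `σ x = α x` cannot be solved approximately with `‖x‖ = 1`, since `σ` is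
isometric; the bound does not depend on `α`. -/
theorem le_scaleBody {N : Structure.{u} LPσ} (hN : Models N (MVFσ.{u} a b)) {α : N.Carrier}
    (h1 : (N.rel (n := 1) (MvPolynomial.X 0 : MvPolynomial (Fin 1) ℤ) (fun _ => α) : ℝ) < 1)
    (h2 : dist α (inftyOf (reduct N)) = 1) (x : N.Carrier) :
    (1 / 4 : ℝ) ≤ scaleBody N α x := by
  by_contra! h
  rw [scaleBody] at h
  have hmax (p q : I) : ((max p q : I) : ℝ) = max (p : ℝ) (q : ℝ) := rfl
  rw [hmax, hmax, max_lt_iff, max_lt_iff, unitInterval.coe_symm_eq,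
    unitInterval.coe_symm_eq] at h
  obtain ⟨h3, h4, h5⟩ := h
  have key := mul_le_max_scalePoly (models_reduct hN) (sigmaOf N x) α x
  have e1 : (reduct N).rel (n := 1) (MvPolynomial.X 0) (fun _ => sigmaOf N x) =
      N.rel (n := 1) (MvPolynomial.X 0 : MvPolynomial (Fin 1) ℤ) fun _ => x :=
    rel_sigma hN (MvPolynomial.X 0) fun _ => x
  have e2 : dist (sigmaOf N x) (inftyOf (reduct N)) = dist x (inftyOf (reduct N)) := by
    conv_lhs => rw [← sigma_infty hN]
    exact (isometry_sigma hN).dist_eq _ _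
  have arith : ∀ Y Dα Dx P Dy A X : ℝ, Y * Dα * Dx ≤ max P (Dy * A * X) → Y = X → Dα = 1 →
      Dy = Dx → A < 1 → P < 1 / 4 → 1 - X < 1 / 4 → 1 - Dx < 1 / 4 → False := by
    rintro Y Dα D P Dy A X key rfl rfl rfl hA hP hX hD
    have h8 : 9 / 16 < Y * Dy := by nlinarith
    rcases le_max_iff.1 key with h | h <;> nlinarith
  exact arith _ _ _ _ _ _ _ key (congrArg Subtype.val e1) h2 e2 h1 h3 h4 h5

end ScaleFormula

/-! ### Characteristics -/

theorem hasCharPair_of_norm {K : Type u} [NormedField K] [IsUltrametricDist K] {a b : ℕ}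
    (h0 : ∀ n : ℕ, ‖(n : K)‖ = 0 ↔ a ∣ n) (h1 : ∀ n : ℕ, ‖(n : K)‖ < 1 ↔ b ∣ n) :
    HasCharPair K a b := by
  refine ⟨⟨fun n => by rw [← h0, norm_eq_zero]⟩, ⟨fun n => ?_⟩⟩
  rw [← map_natCast (IsLocalRing.residue
    (NormedField.valuation (K := K)).valuationSubring) n, IsLocalRing.residue_eq_zero_iff,
    Valuation.mem_maximalIdeal_iff, NormedField.valuation_apply, ← h1, ← NNReal.coe_lt_coe]
  simp

/-! ### Metric valued fields with prescribed norms of integers -/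

/-- A complete field with a prescribed valuation on `ℤ` and an element of norm `ρ`. -/
theorem exists_field_with_element (w : Valuation ℤ ℝ≥0) {ρ : ℝ} (hρ : 0 < ρ) :
    ∃ (K : Type u) (_ : NormedField K) (_ : IsUltrametricDist K) (_ : CompleteSpace K) (t : K),
      ‖t‖ = ρ ∧ ∀ z : ℤ, ‖(z : K)‖ = w z := by
  obtain ⟨K₀, _, _, _, ι, hι, -⟩ :=
    exists_complete_field (w.comap (ULift.ringEquiv.{0, u} (R := ℤ)).toRingHom)
  obtain ⟨K, _, _, _, j, t, hj, ht, -⟩ := exists_gauss_extension K₀ hρ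
  refine ⟨K, inferInstance, inferInstance, inferInstance, t, ht, fun z => ?_⟩
  rw [← map_intCast j, hj, ← map_intCast ι, hι, Valuation.comap_apply, map_intCast]
  rfl

/-- The trivial valuation on `ℤ`. -/
theorem exists_valuation_trivial : ∃ w : Valuation ℤ ℝ≥0,
    (∀ n : ℕ, w n = 0 ↔ 0 ∣ n) ∧ ∀ n : ℕ, w n < 1 ↔ 0 ∣ n := by
  refine ⟨1, fun n => ?_, fun n => ?_⟩
  · simp [zero_dvd_iff]
  · by_cases h : n = 0
    · simp [h]
    · simp [h, Valuation.one_apply_of_ne_zero]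

/-- The trivial valuation on `ℤ/p`, seen on `ℤ`. -/
theorem exists_valuation_mod {p : ℕ} (hp : p.Prime) : ∃ w : Valuation ℤ ℝ≥0,
    (∀ n : ℕ, w n = 0 ↔ p ∣ n) ∧ ∀ n : ℕ, w n < 1 ↔ p ∣ n := by
  have : Fact p.Prime := ⟨hp⟩
  refine ⟨(1 : Valuation (ZMod p) ℝ≥0).comap (Int.castRingHom (ZMod p)), fun n => ?_,
    fun n => ?_⟩
  · simp [ZMod.natCast_eq_zero_iff]
  · rw [← ZMod.natCast_eq_zero_iff]
    by_cases h : (n : ZMod p) = 0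
    · simp [h]
    · simp [h, Valuation.one_apply_of_ne_zero]

/-- The `p`-adic valuation on `ℤ` normalised by `|p| = r`. -/
theorem exists_valuation_padic {p : ℕ} (hp : p.Prime) {r : ℝ≥0} (h0 : 0 < r) (h1 : r < 1) :
    ∃ w : Valuation ℤ ℝ≥0,
      (∀ n : ℕ, w n = 0 ↔ 0 ∣ n) ∧ (∀ n : ℕ, w n < 1 ↔ p ∣ n) ∧ w p = r := by
  have : Fact p.Prime := ⟨hp⟩
  let w : Valuation ℤ ℝ≥0 :=
    { toFun := fun z => if z = 0 then 0 else r ^ padicValInt p z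
      map_zero' := by simp
      map_one' := by simp
      map_mul' := fun x y => by
        by_cases hx : x = 0
        · simp [hx]
        by_cases hy : y = 0
        · simp [hy]
        simp [hx, hy, padicValInt.mul hx hy, pow_add]
      map_add_le_max' := fun x y => by
        by_cases hx : x = 0
        · simp [hx]
        by_cases hy : y = 0
        · simp [hy]
        by_cases hxy : x + y = 0
        · simp [hxy]
        simp only [hx, hy, hxy, if_false]
        have hm : min (padicValInt p x) (padicValInt p y) ≤ padicValInt p (x + y) := by
          refine ((padicValInt_dvd_iff _ _).1 (dvd_add ?_ ?_)).resolve_left hxy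
          · exact (padicValInt_dvd_iff _ _).2 (Or.inr (min_le_left _ _))
          · exact (padicValInt_dvd_iff _ _).2 (Or.inr (min_le_right _ _))
        rcases min_le_iff.1 hm with h | h
        · exact le_max_of_le_left (pow_le_pow_of_le_one zero_le h1.le h)
        · exact le_max_of_le_right (pow_le_pow_of_le_one zero_le h1.le h) }
  have hw (n : ℕ) : w n = if n = 0 then 0 else r ^ padicValNat p n := by
    change (if (n : ℤ) = 0 then 0 else r ^ padicValInt p n) = _
    simp [padicValInt]
  refine ⟨w, fun n => ?_, fun n => ?_, ?_⟩
  · rw [hw]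
    by_cases h : n = 0 <;> simp [h, h0.ne']
  · rw [hw]
    by_cases h : n = 0
    · simp [h]
    · rw [if_neg h, dvd_iff_padicValNat_ne_zero h]
      refine ⟨fun hlt h' => ?_, fun h' => pow_lt_one₀ zero_le h1 h'⟩
      rw [h', pow_zero] at hlt
      exact lt_irrefl _ hlt
  · rw [hw]
    simp [hp.ne_zero]

/-! ### Nonexistence of the model-companion -/

/-- The predicate `‖z‖` of an integer `z`. -/
noncomputable def intNorm (N : Structure.{u} LPσ) (z : ℤ) : I :=
  N.rel (n := 0) (MvPolynomial.C z : MvPolynomial (Fin 0) ℤ) Fin.elim0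

theorem intNorm_embedding {N N' : Structure.{u} LPσ} {f : N.Carrier → N'.Carrier}
    (hf : IsEmbedding N N' f) (z : ℤ) : intNorm N' z = intNorm N z := by
  refine Eq.trans ?_ (hf.map_rel (n := 0) (MvPolynomial.C z : MvPolynomial (Fin 0) ℤ) Fin.elim0)
  exact congrArg (N'.rel (n := 0) _) (Subsingleton.elim _ _)

theorem intNorm_projLineσ {K : Type u} [NormedField K] [IsUltrametricDist K] [CompleteSpace K]
    {s : K →+* K} (hs : ∀ x, ‖s x‖ = ‖x‖) (z : ℤ) :
    (intNorm (projLineσ K s hs) z : ℝ) = ‖(z : K)‖ :=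
  pval_C z _

theorem models_normEq_iff (N : Structure.{u} LPσ) (p : ℕ) (r : I) :
    Sentence.value N (normEq p r) = 0 ↔
      intNorm N p = r := by
  have e : (fun j => Term.eval N Fin.elim0 ((Fin.elim0 : Fin 0 → Term LPσ 0) j)) =
      (Fin.elim0 : Fin 0 → N.Carrier) := Subsingleton.elim _ _
  have h : Sentence.value N (normEq p r) = absDiff ![intNorm N p, r] := by
    rw [intNorm, ← e]
    simp only [Sentence.value, normEq, Formula.eq, Formula.eval]
    congr 1
    ext j
    fin_cases j <;> rfl
  rw [h, ← Subtype.coe_inj]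
  change |((_ : I) : ℝ) - ((_ : I) : ℝ)| = 0 ↔ _
  rw [abs_eq_zero, sub_eq_zero, Subtype.coe_inj]
  rfl

/-- Let `T₀` extend `MVFσ a b` and hold in all projective lines with an isometric automorphism
over metric valued fields of characteristic `(a, b)` in which the integers have the norms given by
`w`. Then `T₀` has no model-companion. -/
theorem not_exists_isModelCompanion {a b : ℕ} (w : Valuation ℤ ℝ≥0)
    (hw0 : ∀ n : ℕ, w n = 0 ↔ a ∣ n) (hw1 : ∀ n : ℕ, w n < 1 ↔ b ∣ n) (T₀ : Theory LPσ)
    (hT₀ : ∀ N : Structure.{u} LPσ, Models N T₀ → Models N (MVFσ.{u} a b))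
    (hmod : ∀ (K : Type u) [NormedField K] [IsUltrametricDist K] [CompleteSpace K]
      (s : K →+* K) (hs : ∀ x, ‖s x‖ = ‖x‖), Function.Surjective s → HasCharPair K a b →
      (∀ z : ℤ, ‖(z : K)‖ = w z) → Models (projLineσ K s hs) T₀) :
    ¬ ∃ T : Theory LPσ, IsModelCompanion.{u} T T₀ := by
  rintro ⟨T, hT⟩
  have hchar (K : Type u) [NormedField K] [IsUltrametricDist K]
      (h : ∀ z : ℤ, ‖(z : K)‖ = w z) : HasCharPair K a b := by
    refine hasCharPair_of_norm (fun n => ?_) fun n => ?_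
    · rw [← hw0, ← NNReal.coe_eq_zero, ← h, Int.cast_natCast]
    · rw [← hw1, ← NNReal.coe_lt_coe, ← h, Int.cast_natCast, NNReal.coe_one]
  -- models of `T` with elements of norm `< 1` tending to `1`
  have step : ∀ i : ℕ, ∃ (N : Structure.{u} LPσ) (α : N.Carrier), Models N T ∧
      (∀ z : ℤ, (intNorm N z : ℝ) = w z) ∧
      (N.rel (n := 1) (MvPolynomial.X 0 : MvPolynomial (Fin 1) ℤ) (fun _ => α) : ℝ) =
        1 - 1 / ((i : ℝ) + 2) ∧
      dist α (inftyOf (reduct N)) = 1 ∧ ∀ x, (1 / 4 : ℝ) ≤ scaleBody N α x := by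
    intro i
    have hi : (0 : ℝ) < 1 / ((i : ℝ) + 2) := by positivity
    have hi1 : 1 / ((i : ℝ) + 2) < 1 := by
      rw [div_lt_one (by positivity)]
      have : (0 : ℝ) ≤ i := i.cast_nonneg
      linarith
    obtain ⟨K, _, _, _, t, ht, hK⟩ := exists_field_with_element.{u} w (sub_pos.2 hi1)
    have hM := hmod K (RingHom.id K) (fun _ => rfl) Function.surjective_id (hchar K hK) hK
    obtain ⟨N, hN, f, hf⟩ := hT.embeds _ hM
    obtain ⟨N', hN', g, hg⟩ := hT.embeds' N hN
    have ht1 : ((t, 1) : K × K) ≠ 0 := by simp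
    let α : (projLineσ K (RingHom.id K) fun _ => rfl).Carrier := Projectivization.mk K (t, 1) ht1
    have hnrep : nrep (Projectivization.mk K (t, 1) ht1) = (t, 1) := by
      rw [nrep_mk]
      have : ‖t‖ ≤ 1 := by linarith
      simp [normPair, this]
    have h1 : (N.rel (n := 1) (MvPolynomial.X 0 : MvPolynomial (Fin 1) ℤ) (fun _ => f α) : ℝ) =
        1 - 1 / ((i : ℝ) + 2) := by
      rw [← ht]
      refine (congrArg Subtype.val (hf.map_rel (n := 1)
        (MvPolynomial.X 0 : MvPolynomial (Fin 1) ℤ) fun _ => α)).trans ?_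
      change pval (MvPolynomial.X 0) (fun _ => Projectivization.mk K (t, 1) ht1) = _
      rw [pval_eq_homEval, homEval_X, hnrep]
    have h2 : dist (f α) (inftyOf (reduct N)) = 1 := by
      rw [← embedding_infty hf]
      refine (hf.isometry _ _).trans ?_
      change pdist (Projectivization.mk K (t, 1) ht1) pinfty = 1
      rw [pdist_pinfty, hnrep, norm_one]
    refine ⟨N, f α, hN, fun z => ?_, h1, h2, fun x => ?_⟩
    · rw [← hK z, intNorm_embedding hf, intNorm_projLineσ]
    · rw [← scaleBody_embedding hg]
      refine le_scaleBody (hT₀ _ hN') ?_ ?_ _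
      · refine lt_of_eq_of_lt ((congrArg Subtype.val (hg.map_rel (n := 1)
          (MvPolynomial.X 0 : MvPolynomial (Fin 1) ℤ) fun _ => f α)).trans h1) ?_
        linarith
      · rw [← embedding_infty hg]
        exact (hg.isometry _ _).trans h2
  choose N α hN hz hα hd hbody using step
  -- in their ultraproduct the limit element has norm `1`, but the formula keeps a value `≥ 1/4`
  let P : Structure.{u} LPσ := ultraproduct N
  let β : P.Carrier := umk N α
  have hP : Models P T := models_ultraproduct N hN
  have hcoe {f : ℕ → I} {r : ℝ} (h : Tendsto (fun i => (f i : ℝ)) (hyperfilter ℕ) (𝓝 r)) :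
      (ulim f : ℝ) = r :=
    tendsto_nhds_unique ((continuous_subtype_val.tendsto _).comp (tendsto_ulim f)) h
  have hPz : ∀ z : ℤ, (intNorm P z : ℝ) = w z := by
    intro z
    refine hcoe ?_
    have e (i : ℕ) : (coordRel N (n := 0) (MvPolynomial.C z : MvPolynomial (Fin 0) ℤ)
        (fun j => urep N ((Fin.elim0 : Fin 0 → P.Carrier) j)) i : ℝ) = w z := by
      rw [← hz i z]
      exact congrArg (fun v => ((N i).rel (n := 0)
        (MvPolynomial.C z : MvPolynomial (Fin 0) ℤ) v : ℝ)) (Subsingleton.elim _ _)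
    simp only [e]
    exact tendsto_const_nhds
  have hPα : (P.rel (n := 1) (MvPolynomial.X 0 : MvPolynomial (Fin 1) ℤ) (fun _ => β) : ℝ) =
      1 := by
    refine (congrArg Subtype.val (ultraproduct_rel N (n := 1)
      (MvPolynomial.X 0 : MvPolynomial (Fin 1) ℤ) fun _ => α)).trans (hcoe ?_)
    refine Tendsto.congr (fun i => (hα i).symm) ?_
    have h1 : Tendsto (fun i : ℕ => 1 - 1 / ((i : ℝ) + 2)) atTop (𝓝 (1 - 0)) := by
      refine tendsto_const_nhds.sub ?_
      refine tendsto_const_nhds.div_atTop ?_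
      exact tendsto_atTop_add_const_right _ _ tendsto_natCast_atTop_atTop
    rw [sub_zero] at h1
    exact h1.mono_left Nat.hyperfilter_le_atTop
  have hPd : dist β (inftyOf (reduct P)) = 1 := by
    have e : inftyOf (reduct P) = umk N fun i => inftyOf (reduct (N i)) := by
      have h := ultraproduct_func N (n := 0) FuncPσ.infty Fin.elim0
      refine Eq.trans ?_ (h.trans ?_)
      · exact congrArg (P.func (n := 0) FuncPσ.infty) (Subsingleton.elim _ _)
      · exact congrArg (umk N) (funext fun i => func_infty (reduct (N i)) _)
    rw [e]
    refine (dist_umk N _ _).trans (tendsto_nhds_unique (tendsto_coord_dist N _ _) ?_)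
    exact Tendsto.congr (fun i => (hd i).symm) tendsto_const_nhds
  have hPφ : (1 / 4 : ℝ) ≤ scaleFormula.eval P fun _ => β := by
    refine ge_of_tendsto' ((continuous_subtype_val.tendsto _).comp
      (tendsto_formula_eval N scaleFormula fun _ => α)) fun i => ?_
    rw [Function.comp_apply, scaleFormula_eval]
    have : (⟨1 / 4, by norm_num, by norm_num⟩ : I) ≤ ⨅ x, scaleBody (N i) (α i) x :=
      le_iInf fun x => hbody i x
    exact this
  -- but the ultraproduct has an extension solving the equation
  obtain ⟨N', hN', g, hg⟩ := hT.embeds' P hP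
  obtain ⟨L, _, _, _, τ, hτ, f, x, hτs, hf, hx0, hx1, hx2⟩ :=
    exists_extension_solving (hT₀ _ hN') (g β)
      ((congrArg Subtype.val (hg.map_rel (n := 1)
        (MvPolynomial.X 0 : MvPolynomial (Fin 1) ℤ) fun _ => β)).trans hPα)
      (by
        rw [← embedding_infty hg]
        exact (hg.isometry _ _).trans hPd)
  have hLz : ∀ z : ℤ, ‖(z : L)‖ = w z := by
    intro z
    rw [← hPz z, ← intNorm_embedding hg, ← intNorm_embedding hf, intNorm_projLineσ]
  obtain ⟨Q, hQ, k, hk⟩ := hT.embeds _ (hmod L τ hτ hτs (hchar L hLz) hLz)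
  have hel := hT.modelComplete P Q hP hQ _ (hk.comp (hf.comp hg)) scaleFormula fun _ => β
  rw [← hel, scaleFormula_eval] at hPφ
  have hle : (⨅ y, scaleBody Q (k (f (g β))) y) ≤ scaleBody Q (k (f (g β))) (k x) :=
    iInf_le _ _
  have hzero : scaleBody Q (k (f (g β))) (k x) = 0 := by
    refine (scaleBody_embedding hk (f (g β)) x).trans ?_
    have e1 : (projLineσ L τ hτ).rel (n := 3) scalePoly
        ![sigmaOf (projLineσ L τ hτ) x, f (g β), x] = 0 := Subtype.ext hx0
    have e2 : (projLineσ L τ hτ).rel (n := 1) (MvPolynomial.X 0 : MvPolynomial (Fin 1) ℤ)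
        (fun _ => x) = 1 := by
      refine Subtype.ext ?_
      change pval (MvPolynomial.X 0) (fun _ => x) = 1
      rw [pval_eq_homEval, homEval_X, hx1]
    exact scaleBody_eq_zero e1 e2 ((pdist_pinfty x).trans hx2)
  have hfin : (1 / 4 : ℝ) ≤ ((0 : I) : ℝ) := hPφ.trans (hzero ▸ hle)
  norm_num at hfin

end MetricValued

theorem theoremC :
    (∀ a b : ℕ,
      ((a = 0 ∧ b = 0) ∨ (∃ p : ℕ, p.Prime ∧ a = 0 ∧ b = p) ∨
        (∃ p : ℕ, p.Prime ∧ a = p ∧ b = p)) →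
      ¬ ∃ T : ContLogic.Theory MetricValued.LPσ,
        ContLogic.IsModelCompanion.{u} T (MetricValued.MVFσ.{u} a b)) ∧
    (∀ (p : ℕ) (r : unitInterval), p.Prime → 0 < r → r < 1 →
      ¬ ∃ T : ContLogic.Theory MetricValued.LPσ,
        ContLogic.IsModelCompanion.{u} T
          (MetricValued.MVFσ.{u} 0 p ∪ {MetricValued.normEq p r})) := by
  constructor
  · rintro a b (⟨rfl, rfl⟩ | ⟨p, hp, rfl, rfl⟩ | ⟨p, hp, rfl, rfl⟩)
    · obtain ⟨w, h0, h1⟩ := MetricValued.exists_valuation_trivial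
      exact MetricValued.not_exists_isModelCompanion w h0 h1 _ (fun _ h => h)
        fun K _ _ _ s hs hsurj hK _ => MetricValued.models_projLineσ hs hK hsurj
    · -- any normalisation of the valuation will do
      obtain ⟨w, h0, h1, -⟩ := MetricValued.exists_valuation_padic hp (r := 1 / 2)
        (by norm_num) (by norm_num)
      exact MetricValued.not_exists_isModelCompanion w h0 h1 _ (fun _ h => h)
        fun K _ _ _ s hs hsurj hK _ => MetricValued.models_projLineσ hs hK hsurj
    · obtain ⟨w, h0, h1⟩ := MetricValued.exists_valuation_mod hp
      exact MetricValued.not_exists_isModelCompanion w h0 h1 _ (fun _ h => h)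
        fun K _ _ _ s hs hsurj hK _ => MetricValued.models_projLineσ hs hK hsurj
  · intro p r hp hr0 hr1
    obtain ⟨w, h0, h1, hwp⟩ := MetricValued.exists_valuation_padic hp
      (r := ⟨(r : ℝ), r.2.1⟩) hr0 hr1
    refine MetricValued.not_exists_isModelCompanion w h0 h1 _
      (fun N h φ hφ => h φ (Or.inl hφ)) fun K _ _ _ s hs hsurj hK hz => ?_
    rintro φ (hφ | rfl)
    · exact MetricValued.models_projLineσ hs hK hsurj φ hφ
    · rw [MetricValued.models_normEq_iff]
      refine Subtype.ext ((MetricValued.intNorm_projLineσ hs p).trans ?_)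
      rw [hz, hwp]
      rfl
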